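/- **Setting.** Let $\Omega_h\subset\mathbb R^2$ be a bounded domain of class $C^2$, $\Omega=\Omega_h\times(0,1)$, $x=(x_h,x_3)$, and let $\mu,\kappa>0$, $0<\alpha<1$. Let $F(x)=g\cdot x+|x_h|^2$ (up to an additive constant) with $g\in\mathbb R^3$, and $\vartheta_B\in C^2(\mathbb R^3)$. Write $\langle\Theta\rangle(x_h)=\int_0^1\Theta(x_h,x_3)\,dx_3$. A strong solution of the rotating Oberbeck–Boussinesq (rOB) system with force $f$ on a time interval $J$ is a pair $(u_h,\Theta)$ with $$u_h\in L^2_{loc}(J;W^{2,2}(\Omega_h;\mathbb R^2)),\ \partial_tu_h\in L^2_{loc}(J;L^2(\Omega_h;\mathbb R^2)),\quad \Theta\in L^2_{loc}(J;W^{2,2}(\Omega)),\ \partial_t\Theta\in L^2_{loc}(J;L^2(\Omega)),$$ satisfying, for some pressure $\Pi$ (with $\Pi(t)\in W^{1,2}(\Omega_h)$ for a.e. $t$), $$\mathrm{div}_hu_h=0,\quad \partial_tu_h+\mathrm{div}_h(u_h\otimes u_h)+\nabla_h\Pi=\mu\Delta_hu_h-\langle\Theta\rangle\nabla_hF+f\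 \text{ a.e. in }J\times\Omega_h,$$ $$\partial_t\Theta+\mathrm{div}_x(\Theta u_h)=\kappa\Delta_x\Theta\ \text{ a.e. in }J\times\Omega,\qquad u_h|_{\partial\Omega_h}=0,\quad \Theta|_{\partial\Omega}=\vartheta_B-\frac{\alpha}{|\Omega|}\int_\Omega\Theta\,dx .$$ For $\mathcal E\in\mathbb R$ let $\mathcal A$ be the set of all entire strong solutions ($J=\mathbb R$, $f=0$) with $(u_h,\Theta)\in BC(\mathbb R;W^{1,2}_0(\Omega_h;\mathbb R^2)\times(W^{1,2}\cap L^\infty)(\Omega))$ and, for all $\tau\in\mathbb R$, $$\|u_h(\tau)\|_{W^{1,2}(\Omega_h)}+\|\Theta(\tau)\|_{W^{1,2}(\Omega)}+\|\Theta(\tau)\|_{L^\infty(\Omega)}\le\mathcal E,$$ $$\int_\tau^{\tau+1}\!\big(\|\partial_tu_h\|_{L^2(\Omega_h)}+\|u_h\|_{W^{2,2}(\Omega_h)}+\|\partial_t\Theta\|_{L^2(\Omega)}+\|\Theta\|_{W^{2,2}(\Omega)}\big)dt\le\mathcal E.$$ Interpolants are maps $I_\delta$, $\delta>0$ (not necessarily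 linear), of $L^2(\Omega_h;\mathbb R^2)$ into itself such that, for some functions $\bar I$ and $\rho$ with $\rho(\delta)\to0$ as $\delta\to0^+$, $$\|I_\delta[v]\|_{L^2}\le\bar I(\|v\|_{L^2})\ \ (v\in L^2),\qquad \|I_\delta[v]-v\|_{L^2}\le\rho(\delta)\|v\|_{W^{1,2}}\ \ (v\in W^{1,2}).$$ **Theorem 4.1 (Convergence of the data assimilation method).** For every $\mathcal E,M\in\mathbb R$ there are $\Lambda_0>0$, $\beta>0$, $C>0$, depending only on $\Omega_h,\mu,\kappa,\alpha,\mathcal E,M$, such that for every $\Lambda\ge\Lambda_0$ and every rate $\rho$ as above there is $\delta_0=\delta_0(\Lambda,\rho)>0$ (depending otherwise only on the same data) with the following property. Let $0<\delta\le\delta_0$, let $(I_\delta)_{\delta>0}$ be interpolants with rate $\rho$, let $g$ be such that $|\nabla_hF|\le M$ in $\Omega_h$, let $\vartheta_B\in C^2(\mathbb R^3)$, let $(u_h,\Theta)\in\mathcal A$ be an entire solution, and let $(\tilde u_h,\tilde\Theta)$ be a strong solution of the nudged system, i.e. of the rOB system with the force $f=-\Lambda I_\delta[\tilde u_h-u_h]$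 and the same $F$, $\vartheta_B$, on an interval $J$ with $\min J=0$ (for instance $J=[0,\infty)$), with initial data $(\tilde u_h,\tilde\Theta)(0)=(\tilde u_{0,h},\tilde\Theta_0)$. Then for all $\tau\in J$ $$\|(u_h-\tilde u_h)(\tau,\cdot)\|_{L^2(\Omega_h;\mathbb R^2)}+\|(\Theta-\tilde\Theta)(\tau,\cdot)\|_{L^2(\Omega)}\le C\big(1+\|\tilde u_{0,h}\|_{L^2(\Omega_h;\mathbb R^2)}+\|\tilde\Theta_0\|_{L^2(\Omega)}\big)e^{-\beta\tau}.$$ -/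

import Mathlib

open MeasureTheory Filter Topology Set
open scoped ContDiff

noncomputable section

namespace ROB

/-- The horizontal plane, with points `x_h`. -/
abbrev R2 : Type := EuclideanSpace ℝ (Fin 2)

/-- Physical space, with points `x = (x_h, x_3)`; its `volume` is the Lebesgue measure. -/
abbrev R3 : Type := R2 × ℝ

/-- The coordinate directions of the plane. -/
def e2 (i : Fin 2) : R2 := EuclideanSpace.single i 1

/-- The coordinate directions of space: two horizontal ones and the vertical one. -/
def e3 : Fin 3 → R3 := ![(e2 0, 0), (e2 1, 0), (0, 1)]

/-- A bounded domain (non-empty, open, connected) of class `C²` in the plane: near every boundary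
point it is the sublevel set `{ψ < 0}` of a `C²` function with non-vanishing differential. -/
structure IsC2Domain (D : Set R2) : Prop where
  isOpen : IsOpen D
  isConnected : IsConnected D
  isBounded : Bornology.IsBounded D
  boundary : ∀ p ∈ frontier D, ∃ U ∈ 𝓝 p, ∃ ψ : R2 → ℝ,
    ContDiff ℝ 2 ψ ∧ fderiv ℝ ψ p ≠ 0 ∧ D ∩ U = {x ∈ U | ψ x < 0}

/-- The cylinder `Ω = Ω_h × (0,1)`. -/
def cyl (D : Set R2) : Set R3 := D ×ˢ Ioo (0 : ℝ) 1

section Sobolev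

/-- Real `L²(Ω)`. -/
abbrev L2 {E : Type} [MeasureSpace E] (Ω : Set E) : Type :=
  Lp ℝ 2 (volume.restrict Ω : Measure E)

variable {E : Type} [NormedAddCommGroup E] [NormedSpace ℝ E] [MeasureSpace E]
variable {ι : Type} [Fintype ι]

/-- Test functions: `φ ∈ C_c^∞(Ω)`. -/
def IsTestFunction (Ω : Set E) (φ : E → ℝ) : Prop :=
  ContDiff ℝ ∞ φ ∧ HasCompactSupport φ ∧ tsupport φ ⊆ Ω

/-- `g` is the weak derivative of `f` in `Ω` in the direction `v`. -/
def HasWeakDeriv (Ω : Set E) (v : E) (f g : L2 Ω) : Prop :=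
  ∀ φ : E → ℝ, IsTestFunction Ω φ →
    ∫ x in Ω, f x * fderiv ℝ φ x v = - ∫ x in Ω, g x * φ x

/-- Weak derivatives in an open set are unique. -/
theorem HasWeakDeriv.unique [FiniteDimensional ℝ E] [BorelSpace E]
    [IsLocallyFiniteMeasure (volume : Measure E)] {Ω : Set E} (hΩ : IsOpen Ω) {v : E}
    {f g h : L2 Ω} (hg : HasWeakDeriv Ω v f g) (hh : HasWeakDeriv Ω v f h) : g = h := by
  have hloc : ∀ k : L2 Ω, LocallyIntegrable k (volume.restrict Ω) := fun k =>
    (Lp.memLp k).locallyIntegrable (by norm_num)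
  have hmul : ∀ (k : L2 Ω) (φ : E → ℝ), IsTestFunction Ω φ →
      Integrable (fun x => k x * φ x) (volume.restrict Ω) := fun k φ hφ => by
    simpa [mul_comm] using
      (hloc k).integrable_smul_left_of_hasCompactSupport hφ.1.continuous hφ.2.1
  have key : ∀ᵐ x ∂(volume : Measure E), x ∈ Ω → (g x - h x) = 0 := by
    refine hΩ.ae_eq_zero_of_integral_contDiff_smul_eq_zero (f := fun x => g x - h x)
      (locallyIntegrableOn_of_locallyIntegrable_restrict ((hloc g).sub (hloc h))) ?_
    intro φ h1 h2 h3
    have e := (hg φ ⟨h1, h2, h3⟩).symm.trans (hh φ ⟨h1, h2, h3⟩)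
    rw [← setIntegral_eq_integral_of_forall_compl_eq_zero (s := Ω)]
    · rw [integral_congr_ae (g := fun x => g x * φ x - h x * φ x),
        integral_sub (hmul g φ ⟨h1, h2, h3⟩) (hmul h φ ⟨h1, h2, h3⟩)]
      · linarith
      · exact Eventually.of_forall fun x => by simp only [smul_eq_mul]; ring
    · intro x hx
      have : φ x = 0 := by
        by_contra h0
        exact hx (h3 (subset_tsupport φ h0))
      simp [this]
  apply Lp.ext
  filter_upwards [(ae_restrict_iff' hΩ.measurableSet).2 key] with x hx using sub_eq_zero.1 hx

open Classical in
/-- The weak derivative of `f` in the direction `v` (zero if there is none in `L²(Ω)`); it is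
unique when `Ω` is open. -/
def weakDeriv (Ω : Set E) (v : E) (f : L2 Ω) : L2 Ω :=
  if h : ∃ g, HasWeakDeriv Ω v f g then h.choose else 0

/-- `f ∈ W^{1,2}(Ω)`, the partial derivatives being taken along the directions `e i`. -/
def MemW12 (e : ι → E) (Ω : Set E) (f : L2 Ω) : Prop :=
  ∀ i, ∃ g, HasWeakDeriv Ω (e i) f g

/-- `f ∈ W^{2,2}(Ω)`. -/
def MemW22 (e : ι → E) (Ω : Set E) (f : L2 Ω) : Prop :=
  MemW12 e Ω f ∧ ∀ i, MemW12 e Ω (weakDeriv Ω (e i) f)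

/-- The norm of `W^{1,2}(Ω)`. -/
def w12Norm (e : ι → E) (Ω : Set E) (f : L2 Ω) : ℝ :=
  √(‖f‖ ^ 2 + ∑ i, ‖weakDeriv Ω (e i) f‖ ^ 2)

/-- The norm of `W^{2,2}(Ω)`. -/
def w22Norm (e : ι → E) (Ω : Set E) (f : L2 Ω) : ℝ :=
  √(‖f‖ ^ 2 + ∑ i, ‖weakDeriv Ω (e i) f‖ ^ 2
    + ∑ i, ∑ j, ‖weakDeriv Ω (e j) (weakDeriv Ω (e i) f)‖ ^ 2)

/-- `f ∈ W^{1,2}_0(Ω)`, the closure of `C_c^∞(Ω)` in `W^{1,2}(Ω)`. -/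
def MemW120 (e : ι → E) (Ω : Set E) (f : L2 Ω) : Prop :=
  MemW12 e Ω f ∧ ∀ ε > 0, ∃ φ : E → ℝ, IsTestFunction Ω φ ∧
    ∃ ψ : L2 Ω, (ψ =ᵐ[volume.restrict Ω] φ) ∧ w12Norm e Ω (f - ψ) < ε

/-- The norm of `L^∞(Ω)` (meaningful for essentially bounded `f`). -/
def linfNorm (Ω : Set E) (f : L2 Ω) : ℝ :=
  (eLpNorm f ⊤ (volume.restrict Ω)).toReal

end Sobolev

/-- `L²(Ω_h; R²)`, written in components, with the Hilbert norm `(‖v₁‖² + ‖v₂‖²)^{1/2}`. -/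
abbrev L2v (D : Set R2) : Type := PiLp 2 (fun _ : Fin 2 => L2 D)

/-- The norm of `W^{1,2}(Ω_h; R²)`. -/
def w12NormV (D : Set R2) (v : L2v D) : ℝ := √(∑ i, w12Norm e2 D (v i) ^ 2)

/-- The norm of `W^{2,2}(Ω_h; R²)`. -/
def w22NormV (D : Set R2) (v : L2v D) : ℝ := √(∑ i, w22Norm e2 D (v i) ^ 2)

/-- A curve `w` in a Banach space that belongs to `W^{1,2}_loc(J; X)`: it is the integral of its
time derivative, which is square integrable on the compact subintervals of `J`. -/
def MemTimeW12 {X : Type} [NormedAddCommGroup X] [NormedSpace ℝ X] (J : Set ℝ) (w : ℝ → X) :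
    Prop :=
  ∀ a ∈ J, ∀ b ∈ J, a ≤ b →
    MemLp (deriv w) 2 (volume.restrict (Icc a b)) ∧ w b - w a = ∫ t in a..b, deriv w t

/-- The forcing potential `F(x) = g · x + |x_h|²` (up to an irrelevant additive constant). -/
def potential (g x : R3) : ℝ := inner ℝ g.1 x.1 + g.2 * x.2 + ‖x.1‖ ^ 2

/-- The horizontal gradient `∇_h F`. -/
def gradH (g x : R3) : R2 :=
  WithLp.toLp 2 (fun i => fderiv ℝ (potential g) x (e2 i, 0))

/-- `∇_h F` depends on the horizontal variable only. -/
theorem gradH_apply (g x : R3) (i : Fin 2) : gradH g x i = g.1 i + 2 * x.1 i := by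
  have h1 : HasFDerivAt (fun x : R3 => inner ℝ g.1 x.1)
      ((innerSL ℝ g.1).comp (ContinuousLinearMap.fst ℝ R2 ℝ)) x :=
    ((innerSL ℝ g.1).comp (ContinuousLinearMap.fst ℝ R2 ℝ)).hasFDerivAt
  have h2 : HasFDerivAt (fun x : R3 => g.2 * x.2)
      (g.2 • ContinuousLinearMap.snd ℝ R2 ℝ) x :=
    (ContinuousLinearMap.snd ℝ R2 ℝ).hasFDerivAt.const_mul g.2
  have h3 : HasFDerivAt (fun x : R3 => ‖x.1‖ ^ 2)
      (2 • (innerSL ℝ x.1).comp (ContinuousLinearMap.fst ℝ R2 ℝ)) x :=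
    (ContinuousLinearMap.fst ℝ R2 ℝ).hasFDerivAt.norm_sq
  have h : HasFDerivAt (potential g) _ x := (h1.add h2).add h3
  simp [gradH, h.fderiv, e2, EuclideanSpace.inner_single_right]

/-- The vertical average `⟨Θ⟩(x_h) = ∫₀¹ Θ(x_h, x_3) dx_3`. -/
def vAvg {D : Set R2} (Θ : L2 (cyl D)) (x : R2) : ℝ := ∫ s in (0 : ℝ)..1, Θ (x, s)

/-- The parameters of the rotating Oberbeck-Boussinesq system: viscosity `μ`, heat conductivity `κ`,
the coefficient `α` of the nonlocal boundary condition, the vector `g` in the potential `F`, and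
the boundary temperature `ϑ_B`, extended to the whole space. -/
structure Params where
  μ : ℝ
  κ : ℝ
  α : ℝ
  g : R3
  θB : R3 → ℝ

/-- `(u, Θ)` is a strong solution, on the time interval `J`, of the rotating Oberbeck-Boussinesq
system with an additional force `f(t) ∈ L²(Ω_h; R²)` in the momentum equation. As
`div_h u = 0`, the convective terms `div_h (u ⊗ u)` and `div_x (Θ u)` are `u · ∇_h u` and
`u · ∇_h Θ`. -/
structure IsStrongSolution (D : Set R2) (P : Params) (J : Set ℝ) (f : ℝ → L2v D)
    (u : ℝ → L2v D) (Θ : ℝ → L2 (cyl D)) : Prop where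
  /-- `∂_t u ∈ L²_loc(J; L²(Ω_h; R²))` -/
  time_u : MemTimeW12 J u
  /-- `∂_t Θ ∈ L²_loc(J; L²(Ω))` -/
  time_Θ : MemTimeW12 J Θ
  /-- `u ∈ L²_loc(J; W^{2,2}(Ω_h; R²))` -/
  space_u : (∀ᵐ t ∂volume.restrict J, ∀ i, MemW22 e2 D (u t i)) ∧
    ∀ a ∈ J, ∀ b ∈ J, IntegrableOn (fun t => w22NormV D (u t) ^ 2) (Icc a b)
  /-- `Θ ∈ L²_loc(J; W^{2,2}(Ω))` -/
  space_Θ : (∀ᵐ t ∂volume.restrict J, MemW22 e3 (cyl D) (Θ t)) ∧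
    ∀ a ∈ J, ∀ b ∈ J, IntegrableOn (fun t => w22Norm e3 (cyl D) (Θ t) ^ 2) (Icc a b)
  /-- `div_h u = 0` -/
  div_free : ∀ᵐ t ∂volume.restrict J, ∑ i, weakDeriv D (e2 i) (u t i) = 0
  /-- `∂_t u + div_h (u ⊗ u) + ∇_h p = μ Δ_h u - ⟨Θ⟩ ∇_h F + f` -/
  momentum : ∀ᵐ t ∂volume.restrict J, ∃ p : L2 D, MemW12 e2 D p ∧
    ∀ i, ∀ᵐ x ∂volume.restrict D,
      (deriv u t i) x + ∑ j, (u t j) x * (weakDeriv D (e2 j) (u t i)) x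
          + (weakDeriv D (e2 i) p) x
        = P.μ * ∑ j, (weakDeriv D (e2 j) (weakDeriv D (e2 j) (u t i))) x
          - vAvg (Θ t) x * gradH P.g (x, 0) i + (f t i) x
  /-- `∂_t Θ + div_x (Θ u) = κ Δ_x Θ` -/
  heat : ∀ᵐ t ∂volume.restrict J, ∀ᵐ x ∂volume.restrict (cyl D),
    (deriv Θ t) x + ∑ j : Fin 2, (u t j) x.1 * (weakDeriv (cyl D) (e2 j, 0) (Θ t)) x
      = P.κ * ∑ k, (weakDeriv (cyl D) (e3 k) (weakDeriv (cyl D) (e3 k) (Θ t))) x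
  /-- `u = 0` on `∂Ω_h` -/
  bc_u : ∀ᵐ t ∂volume.restrict J, ∀ i, MemW120 e2 D (u t i)
  /-- `Θ = ϑ_B - α ⨍_Ω Θ` on `∂Ω` -/
  bc_Θ : ∀ᵐ t ∂volume.restrict J, ∃ z : L2 (cyl D),
    (∀ᵐ x ∂volume.restrict (cyl D),
      z x = (Θ t) x - (P.θB x - P.α * ⨍ y in cyl D, (Θ t) y)) ∧ MemW120 e3 (cyl D) z

/-- The attractor `𝒜`: the entire strong solutions in
`BC(ℝ; W^{1,2}_0(Ω_h; R²) × (W^{1,2} ∩ L^∞)(Ω))` that satisfy the two uniform bounds by `ℰ`. -/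
structure IsInAttractor (D : Set R2) (P : Params) (ℰ : ℝ)
    (u : ℝ → L2v D) (Θ : ℝ → L2 (cyl D)) : Prop where
  solution : IsStrongSolution D P univ (fun _ => 0) u Θ
  mem_u : ∀ t i, MemW120 e2 D (u t i)
  mem_Θ : ∀ t, MemW12 e3 (cyl D) (Θ t) ∧ MemLp (Θ t) ⊤ (volume.restrict (cyl D))
  cont_u : ∀ t, Tendsto (fun s => w12NormV D (u s - u t)) (𝓝 t) (𝓝 0)
  cont_Θ : ∀ t, Tendsto
    (fun s => w12Norm e3 (cyl D) (Θ s - Θ t) + linfNorm (cyl D) (Θ s - Θ t)) (𝓝 t) (𝓝 0)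
  bound_sup : ∀ τ, w12NormV D (u τ) + w12Norm e3 (cyl D) (Θ τ) + linfNorm (cyl D) (Θ τ) ≤ ℰ
  bound_int : ∀ τ, ∫ t in τ..(τ + 1), (‖deriv u t‖ + w22NormV D (u t) + ‖deriv Θ t‖
    + w22Norm e3 (cyl D) (Θ t)) ≤ ℰ

/-- A family of (not necessarily linear) interpolants `I_δ`, `δ > 0`, on `L²(Ω_h; R²)` with
`‖I_δ[v]‖ ≤ Ibar(‖v‖)` and `‖I_δ[v] - v‖ ≤ ρ(δ) ‖v‖_{W^{1,2}}`. -/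
structure IsInterpolant (D : Set R2) (Ibar ρ : ℝ → ℝ) (I : ℝ → L2v D → L2v D) : Prop where
  bound : ∀ δ > 0, ∀ v, ‖I δ v‖ ≤ Ibar ‖v‖
  approx : ∀ δ > 0, ∀ v, (∀ i, MemW12 e2 D (v i)) → ‖I δ v - v‖ ≤ ρ δ * w12NormV D v

/-- `(v, Ξ)` is a strong solution on `J` of the nudged system: the force is
`- Λ I_δ[v - u]`, where `u` is the observed velocity. -/
def IsNudgedSolution (D : Set R2) (P : Params) (J : Set ℝ) (Λ : ℝ) (Iδ : L2v D → L2v D)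
    (u : ℝ → L2v D) (v : ℝ → L2v D) (Ξ : ℝ → L2 (cyl D)) : Prop :=
  IsStrongSolution D P J (fun t => -(Λ • Iδ (v t - u t))) v Ξ

end ROB

end

set_option linter.unusedSectionVars false

namespace ROB

/-! The proof is an energy estimate for the synchronization error $w=u_h-\tilde u_h$,
$\eta=\Theta-\tilde\Theta$, in which every bound on coefficients falls on the attractor solution.

Testing the difference of the momentum equations with $w$ removes the pressure and the transport of
$w$ by $\tilde u_h$, both by incompressibility. What remains of the convection is $\int
(w\cdot\nabla u_h)\cdot w$, at most $C\mathcal E\|w\|\|\nabla w\|$ by Ladyzhenskaya's inequality.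
The nudging contributes $-\Lambda\|w\|^2$ and an interpolation error, at most $(\|w\|+\|\nabla
w\|)\|w\|$ once $\Lambda|\rho(\delta)|\le 1$.

The nonlocal boundary condition gives $\eta=-\alpha|\Omega|^{-1}\int\eta$ on the boundary, so $\eta$
itself is not an admissible test function, but $z=\eta+\alpha|\Omega|^{-1}\int\eta$ is. It has the
gradient of $\eta$, and $\langle\partial_t\eta,z\rangle$ is half the derivative of
$\|\eta\|^2+\alpha|\Omega|^{-1}(\int\eta)^2$. Transport of $z$ by $\tilde u_h$ vanishes again; in
$\int (w\cdot\nabla\Theta)z$ the derivative is moved to $z$, which costs only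
$\|\Theta\|_\infty\le\mathcal E$.

By Poincaré's inequality for $z$ the buoyancy is at most a multiple of $\|w\|\|\nabla z\|$. All bad
terms then contain a factor $\|w\|$, and Young's inequality with a large $\Lambda$ absorbs them. The
remaining dissipation controls the energy, which decays exponentially. The estimates are
`velocity_difference`, `temperature_difference`, `inner_nudging_le` and `dissipation_le`;
`exists_energy_decay` combines them. -/

theorem inner_L2 {X : Type} [MeasureSpace X] {S : Set X} (f g : L2 S) :
    inner ℝ f g = ∫ x in S, f x * g x := by
  rw [L2.inner_def]
  exact integral_congr_ae (.of_forall fun x => by simp [mul_comm])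

/-! ### Weak derivatives and approximation by test functions -/

section General

variable {E : Type} [NormedAddCommGroup E] [NormedSpace ℝ E] [MeasureSpace E] [BorelSpace E]
  [FiniteDimensional ℝ E] [(volume : Measure E).IsAddHaarMeasure]
  {ι : Type} [Fintype ι] {Ω : Set E} {e : ι → E} {φ ψ : E → ℝ}

namespace IsTestFunction

theorem fderiv (h : IsTestFunction Ω φ) (v : E) :
    IsTestFunction Ω (fun x => fderiv ℝ φ x v) := by
  refine ⟨(h.1.fderiv_right (m := ∞) (by simp)).clm_apply contDiff_const, ?_, ?_⟩
  · exact h.2.1.fderiv_apply ℝ v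
  · exact (closure_mono fun x hx => by
      have : _root_.fderiv ℝ φ x ≠ 0 := fun h0 => hx (by simp [h0])
      exact (support_fderiv_subset ℝ this)).trans (by simpa [tsupport] using h.2.2)

theorem mul (h : IsTestFunction Ω φ) (hψ : ContDiff ℝ ∞ ψ) :
    IsTestFunction Ω (fun x => φ x * ψ x) :=
  ⟨h.1.mul hψ, h.2.1.mul_right, (tsupport_mul_subset_left).trans h.2.2⟩

theorem sub (h : IsTestFunction Ω φ) (h' : IsTestFunction Ω ψ) :
    IsTestFunction Ω (fun x => φ x - ψ x) :=
  ⟨h.1.sub h'.1, h.2.1.sub h'.2.1, (tsupport_sub φ ψ).trans (union_subset h.2.2 h'.2.2)⟩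

theorem eq_zero (h : IsTestFunction Ω φ) {x : E} (hx : x ∉ Ω) : φ x = 0 := by
  by_contra h0
  exact hx (h.2.2 (subset_tsupport φ h0))

theorem differentiable (h : IsTestFunction Ω φ) : Differentiable ℝ φ :=
  h.1.differentiable (by simp)

theorem memLp_volume (h : IsTestFunction Ω φ) (p : ENNReal) :
    MemLp φ p (volume : Measure E) :=
  h.1.continuous.memLp_of_hasCompactSupport h.2.1

theorem memLp (h : IsTestFunction Ω φ) (p : ENNReal) : MemLp φ p (volume.restrict Ω) :=
  (h.memLp_volume p).restrict Ω

theorem eLpNorm_restrict (h : IsTestFunction Ω φ) (p : ENNReal) :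
    eLpNorm φ p (volume.restrict Ω) = eLpNorm φ p volume :=
  eLpNorm_restrict_eq_of_support_subset fun _ hx => h.2.2 (subset_tsupport φ hx)

/-- A test function as an element of `L²(Ω)`. -/
noncomputable def toL2 (h : IsTestFunction Ω φ) : L2 Ω := (h.memLp 2).toLp φ

theorem coeFn_toL2 (h : IsTestFunction Ω φ) : h.toL2 =ᵐ[volume.restrict Ω] φ :=
  (h.memLp 2).coeFn_toLp

theorem eq_toL2 (h : IsTestFunction Ω φ) {f : L2 Ω} (hf : f =ᵐ[volume.restrict Ω] φ) :
    f = h.toL2 :=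
  Lp.ext (hf.trans h.coeFn_toL2.symm)

theorem inner_toL2 (h : IsTestFunction Ω φ) (f : L2 Ω) :
    inner ℝ f h.toL2 = ∫ x in Ω, f x * φ x := by
  rw [inner_L2]
  refine integral_congr_ae ?_
  filter_upwards [h.coeFn_toL2] with x hx using by rw [hx]

theorem integral_mul_fderiv (h : IsTestFunction Ω φ) (hψ : IsTestFunction Ω ψ) (v : E) :
    ∫ x in Ω, φ x * _root_.fderiv ℝ ψ x v = - ∫ x in Ω, _root_.fderiv ℝ φ x v * ψ x := by
  rw [setIntegral_eq_integral_of_forall_compl_eq_zero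
      (fun x hx => by rw [h.eq_zero hx, zero_mul]),
    setIntegral_eq_integral_of_forall_compl_eq_zero
      (fun x hx => by rw [hψ.eq_zero hx, mul_zero])]
  exact integral_mul_fderiv_eq_neg_fderiv_mul_of_integrable
    ((h.fderiv v).memLp_volume 2 |>.integrable_mul (hψ.memLp_volume 2))
    ((h.memLp_volume 2).integrable_mul ((hψ.fderiv v).memLp_volume 2))
    ((h.memLp_volume 2).integrable_mul (hψ.memLp_volume 2))
    (fun x _ => h.differentiable x) (fun x _ => hψ.differentiable x)

end IsTestFunction

/-- With test functions viewed in $L^2$, linearity and passage to the limit for weak derivatives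
become properties of the inner product. -/
theorem hasWeakDeriv_iff {v : E} {f g : L2 Ω} :
    HasWeakDeriv Ω v f g ↔ ∀ (φ : E → ℝ) (h : IsTestFunction Ω φ),
      inner ℝ f (h.fderiv v).toL2 = - inner ℝ g h.toL2 := by
  refine forall₂_congr fun φ h => ?_
  rw [h.inner_toL2, (h.fderiv v).inner_toL2]

theorem HasWeakDeriv.sub {v : E} {f g f' g' : L2 Ω} (h : HasWeakDeriv Ω v f g)
    (h' : HasWeakDeriv Ω v f' g') : HasWeakDeriv Ω v (f - f') (g - g') := by
  rw [hasWeakDeriv_iff] at *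
  intro φ hφ
  rw [inner_sub_left, inner_sub_left, h φ hφ, h' φ hφ]
  ring

theorem IsTestFunction.hasWeakDeriv (h : IsTestFunction Ω φ) (v : E) :
    HasWeakDeriv Ω v h.toL2 (h.fderiv v).toL2 := by
  rw [hasWeakDeriv_iff]
  intro ψ hψ
  rw [hψ.inner_toL2, (hψ.fderiv v).inner_toL2]
  have h1 : ∫ x in Ω, h.toL2 x * _root_.fderiv ℝ ψ x v
      = ∫ x in Ω, φ x * _root_.fderiv ℝ ψ x v := integral_congr_ae <| by
    filter_upwards [h.coeFn_toL2] with x hx using by rw [hx]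
  have h2 : ∫ x in Ω, (h.fderiv v).toL2 x * ψ x
      = ∫ x in Ω, _root_.fderiv ℝ φ x v * ψ x := integral_congr_ae <| by
    filter_upwards [(h.fderiv v).coeFn_toL2] with x hx using by rw [hx]
  rw [h1, h2, h.integral_mul_fderiv hψ]

theorem HasWeakDeriv.weakDeriv_eq (hΩ : IsOpen Ω) {v : E} {f g : L2 Ω}
    (h : HasWeakDeriv Ω v f g) : weakDeriv Ω v f = g := by
  have hex : ∃ g, HasWeakDeriv Ω v f g := ⟨g, h⟩
  rw [weakDeriv, dif_pos hex]
  exact HasWeakDeriv.unique hΩ hex.choose_spec h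

theorem MemW12.hasWeakDeriv {f : L2 Ω} (h : MemW12 e Ω f) (i : ι) :
    HasWeakDeriv Ω (e i) f (weakDeriv Ω (e i) f) := by
  rw [weakDeriv, dif_pos (h i)]
  exact (h i).choose_spec

theorem MemW12.sub {f g : L2 Ω} (hf : MemW12 e Ω f) (hg : MemW12 e Ω g) :
    MemW12 e Ω (f - g) :=
  fun i => ⟨_, (hf.hasWeakDeriv i).sub (hg.hasWeakDeriv i)⟩

theorem MemW12.weakDeriv_sub (hΩ : IsOpen Ω) {f g : L2 Ω} (hf : MemW12 e Ω f)
    (hg : MemW12 e Ω g) (i : ι) :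
    weakDeriv Ω (e i) (f - g) = weakDeriv Ω (e i) f - weakDeriv Ω (e i) g :=
  ((hf.hasWeakDeriv i).sub (hg.hasWeakDeriv i)).weakDeriv_eq hΩ

theorem IsTestFunction.memW12 (h : IsTestFunction Ω φ) : MemW12 e Ω h.toL2 :=
  fun i => ⟨_, h.hasWeakDeriv (e i)⟩

theorem IsTestFunction.weakDeriv_toL2 (h : IsTestFunction Ω φ) (hΩ : IsOpen Ω) (v : E) :
    weakDeriv Ω v h.toL2 = (h.fderiv v).toL2 :=
  (h.hasWeakDeriv v).weakDeriv_eq hΩ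

/-- The `L²` norm of the gradient. -/
noncomputable def gradNorm (e : ι → E) (Ω : Set E) (f : L2 Ω) : ℝ :=
  √(∑ i, ‖weakDeriv Ω (e i) f‖ ^ 2)

theorem gradNorm_nonneg (f : L2 Ω) : 0 ≤ gradNorm e Ω f := Real.sqrt_nonneg _

theorem gradNorm_sq (f : L2 Ω) : gradNorm e Ω f ^ 2 = ∑ i, ‖weakDeriv Ω (e i) f‖ ^ 2 :=
  Real.sq_sqrt (by positivity)

theorem norm_weakDeriv_le (f : L2 Ω) (i : ι) : ‖weakDeriv Ω (e i) f‖ ≤ gradNorm e Ω f := by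
  refine Real.le_sqrt_of_sq_le ?_
  exact Finset.single_le_sum (f := fun i => ‖weakDeriv Ω (e i) f‖ ^ 2)
    (fun i _ => by positivity) (Finset.mem_univ i)

theorem w12Norm_sq (f : L2 Ω) : w12Norm e Ω f ^ 2 = ‖f‖ ^ 2 + gradNorm e Ω f ^ 2 := by
  rw [gradNorm_sq, w12Norm, Real.sq_sqrt (by positivity)]

theorem norm_le_w12Norm (f : L2 Ω) : ‖f‖ ≤ w12Norm e Ω f :=
  Real.le_sqrt_of_sq_le (le_add_of_nonneg_right (by positivity))

theorem gradNorm_le_w12Norm (f : L2 Ω) : gradNorm e Ω f ≤ w12Norm e Ω f :=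
  Real.sqrt_le_sqrt (le_add_of_nonneg_left (by positivity))

/-- `φ n` are test functions that converge to `h` in `W^{1,2}(Ω)`. -/
structure W12Approx (e : ι → E) (h : L2 Ω) (φ : ℕ → E → ℝ) : Prop where
  test : ∀ n, IsTestFunction Ω (φ n)
  tendsto : Tendsto (fun n => (test n).toL2) atTop (𝓝 h)
  tendsto_deriv : ∀ i, Tendsto (fun n => ((test n).fderiv (e i)).toL2) atTop
    (𝓝 (weakDeriv Ω (e i) h))

theorem MemW120.exists_approx (hΩ : IsOpen Ω) {h : L2 Ω} (hh : MemW120 e Ω h) :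
    ∃ φ : ℕ → E → ℝ, W12Approx e h φ := by
  have hex : ∀ n : ℕ, ∃ φ : E → ℝ, ∃ hφ : IsTestFunction Ω φ,
      w12Norm e Ω (h - hφ.toL2) < 1 / (n + 1 : ℝ) := fun n => by
    obtain ⟨φ, hφ, ψ, hψ, hlt⟩ := hh.2 (1 / (n + 1 : ℝ)) (by positivity)
    exact ⟨φ, hφ, hφ.eq_toL2 hψ ▸ hlt⟩
  choose φ hφ hlt using hex
  refine ⟨φ, hφ, ?_, fun i => ?_⟩
  · rw [tendsto_iff_norm_sub_tendsto_zero]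
    refine squeeze_zero (fun _ => norm_nonneg _) (fun n => ?_)
      tendsto_one_div_add_atTop_nhds_zero_nat
    rw [norm_sub_rev]
    exact (norm_le_w12Norm _).trans (hlt n).le
  · rw [tendsto_iff_norm_sub_tendsto_zero]
    refine squeeze_zero (fun _ => norm_nonneg _) (fun n => ?_)
      tendsto_one_div_add_atTop_nhds_zero_nat
    rw [norm_sub_rev, ← (hφ n).weakDeriv_toL2 hΩ, ← hh.1.weakDeriv_sub hΩ (hφ n).memW12]
    exact ((norm_weakDeriv_le _ i).trans (gradNorm_le_w12Norm _)).trans (hlt n).le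

theorem W12Approx.tendsto_w12Norm (hΩ : IsOpen Ω) {h : L2 Ω} (hh : MemW12 e Ω h)
    {φ : ℕ → E → ℝ} (hφ : W12Approx e h φ) :
    Tendsto (fun n => w12Norm e Ω (h - (hφ.test n).toL2)) atTop (𝓝 0) := by
  have h0 : √(‖h - h‖ ^ 2 + ∑ i, ‖weakDeriv Ω (e i) h - weakDeriv Ω (e i) h‖ ^ 2) = 0 := by
    simp
  rw [← h0]
  refine Tendsto.congr (f₁ := fun n => √(‖h - (hφ.test n).toL2‖ ^ 2
    + ∑ i, ‖weakDeriv Ω (e i) h - ((hφ.test n).fderiv (e i)).toL2‖ ^ 2)) (fun n => ?_) ?_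
  · simp only [w12Norm, hh.weakDeriv_sub hΩ (hφ.test n).memW12, (hφ.test n).weakDeriv_toL2 hΩ]
  · refine (Tendsto.add ((tendsto_const_nhds.sub hφ.tendsto).norm.pow 2)
      (tendsto_finsetSum _ fun i _ =>
        (tendsto_const_nhds.sub (hφ.tendsto_deriv i)).norm.pow 2)).sqrt

theorem W12Approx.memW120 (hΩ : IsOpen Ω) {h : L2 Ω} (hh : MemW12 e Ω h)
    {φ : ℕ → E → ℝ} (hφ : W12Approx e h φ) : MemW120 e Ω h := by
  refine ⟨hh, fun ε hε => ?_⟩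
  obtain ⟨n, hn⟩ := ((hφ.tendsto_w12Norm hΩ hh).eventually_lt_const hε).exists
  exact ⟨φ n, hφ.test n, (hφ.test n).toL2, (hφ.test n).coeFn_toL2, hn⟩

theorem toL2_sub (h : IsTestFunction Ω φ) (h' : IsTestFunction Ω ψ) :
    (h.sub h').toL2 = h.toL2 - h'.toL2 := by
  symm
  refine (h.sub h').eq_toL2 ?_
  filter_upwards [Lp.coeFn_sub h.toL2 h'.toL2, h.coeFn_toL2, h'.coeFn_toL2] with x h1 h2 h3
  rw [h1, Pi.sub_apply, h2, h3]

theorem fderiv_toL2_sub (h : IsTestFunction Ω φ) (h' : IsTestFunction Ω ψ) (v : E) :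
    ((h.sub h').fderiv v).toL2 = (h.fderiv v).toL2 - (h'.fderiv v).toL2 := by
  rw [← toL2_sub]
  have : (fun x => _root_.fderiv ℝ (fun x => φ x - ψ x) x v)
      = fun x => _root_.fderiv ℝ φ x v - _root_.fderiv ℝ ψ x v := by
    funext x
    rw [fderiv_fun_sub (h.differentiable x) (h'.differentiable x)]
    rfl
  unfold IsTestFunction.toL2
  congr 1

theorem MemW120.sub (hΩ : IsOpen Ω) {f g : L2 Ω} (hf : MemW120 e Ω f) (hg : MemW120 e Ω g) :
    MemW120 e Ω (f - g) := by
  obtain ⟨φ, hφ⟩ := hf.exists_approx hΩ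
  obtain ⟨ψ, hψ⟩ := hg.exists_approx hΩ
  refine W12Approx.memW120 (φ := fun n x => φ n x - ψ n x) hΩ (hf.1.sub hg.1)
    ⟨fun n => (hφ.test n).sub (hψ.test n), ?_, fun i => ?_⟩
  · exact (hφ.tendsto.sub hψ.tendsto).congr fun n => (toL2_sub (hφ.test n) (hψ.test n)).symm
  · rw [hf.1.weakDeriv_sub hΩ hg.1]
    exact ((hφ.tendsto_deriv i).sub (hψ.tendsto_deriv i)).congr fun n =>
      (fderiv_toL2_sub (hφ.test n) (hψ.test n) (e i)).symm

theorem IsTestFunction.memW120 (hΩ : IsOpen Ω) (h : IsTestFunction Ω φ) :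
    MemW120 e Ω h.toL2 :=
  W12Approx.memW120 (φ := fun _ => φ) hΩ h.memW12 ⟨fun _ => h, tendsto_const_nhds, fun i => by
    rw [h.weakDeriv_toL2 hΩ]
    exact tendsto_const_nhds⟩

/-- Integration by parts against a function that vanishes on the boundary. -/
theorem HasWeakDeriv.inner_weakDeriv (hΩ : IsOpen Ω) {f g h : L2 Ω} {i : ι}
    (hf : HasWeakDeriv Ω (e i) f g) (hh : MemW120 e Ω h) :
    inner ℝ f (weakDeriv Ω (e i) h) = - inner ℝ g h := by
  obtain ⟨φ, hφ⟩ := hh.exists_approx hΩ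
  rw [hasWeakDeriv_iff] at hf
  -- The identity is the definition of the weak derivative along the approximating test functions;
  -- both sides pass to the limit in $L^2$.
  refine tendsto_nhds_unique (tendsto_const_nhds.inner (hφ.tendsto_deriv i)) ?_
  simp only [hf _ (hφ.test _)]
  exact (tendsto_const_nhds.inner hφ.tendsto).neg

end General

/-! ### Sobolev and Ladyzhenskaya inequalities on $W^{1,2}_0$ -/

section Embedding

variable {E : Type} [NormedAddCommGroup E] [NormedSpace ℝ E] [MeasureSpace E] [BorelSpace E]
  [FiniteDimensional ℝ E] [(volume : Measure E).IsAddHaarMeasure]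
  {ι : Type} [Fintype ι] {Ω : Set E} {e : ι → E} {φ ψ : E → ℝ}

theorem eLpNorm_L2 {X : Type} [MeasureSpace X] {S : Set X} (f : L2 S) :
    eLpNorm f 2 (volume.restrict S) = ENNReal.ofReal ‖f‖ := by
  rw [Lp.norm_def, ENNReal.ofReal_toReal (Lp.eLpNorm_ne_top f)]

theorem IsTestFunction.eLpNorm_two (h : IsTestFunction Ω φ) :
    eLpNorm φ 2 volume = ENNReal.ofReal ‖h.toL2‖ := by
  rw [← h.eLpNorm_restrict, ← eLpNorm_L2, eLpNorm_congr_ae h.coeFn_toL2]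

/-- The Gagliardo–Nirenberg–Sobolev inequality involves the operator norm of the full differential,
while `gradNorm` uses partial derivatives. The hypothesis `he` compares the two; the crude triangle
inequality costs the factor `Fintype.card ι`. -/
theorem IsTestFunction.eLpNorm_fderiv_le (hΩ : IsOpen Ω) (h : IsTestFunction Ω φ)
    (he : ∀ L : E →L[ℝ] ℝ, ‖L‖ ≤ ∑ i, ‖L (e i)‖) :
    eLpNorm (_root_.fderiv ℝ φ) 2 volume
      ≤ ENNReal.ofReal (Fintype.card ι * gradNorm e Ω h.toL2) := by
  calc eLpNorm (_root_.fderiv ℝ φ) 2 volume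
      ≤ eLpNorm (∑ i, fun x => ‖_root_.fderiv ℝ φ x (e i)‖) 2 volume :=
        eLpNorm_mono_real fun x => by simpa using he (_root_.fderiv ℝ φ x)
    _ ≤ ∑ i, eLpNorm (fun x => ‖_root_.fderiv ℝ φ x (e i)‖) 2 volume :=
        eLpNorm_sum_le (fun i _ => ((h.fderiv (e i)).memLp_volume 2).1.norm) (by norm_num)
    _ = ∑ i, ENNReal.ofReal ‖weakDeriv Ω (e i) h.toL2‖ := by
        refine Finset.sum_congr rfl fun i _ => ?_
        rw [eLpNorm_norm, (h.fderiv (e i)).eLpNorm_two, h.weakDeriv_toL2 hΩ]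
    _ ≤ ∑ _i : ι, ENNReal.ofReal (gradNorm e Ω h.toL2) :=
        Finset.sum_le_sum fun i _ => ENNReal.ofReal_le_ofReal (norm_weakDeriv_le _ i)
    _ = ENNReal.ofReal (Fintype.card ι * gradNorm e Ω h.toL2) := by
        rw [Finset.sum_const, Finset.card_univ, nsmul_eq_mul,
          ENNReal.ofReal_mul (by positivity), ENNReal.ofReal_natCast]

/-- An `L^p` bound that holds for test functions holds in `W^{1,2}_0`. -/
theorem MemW120.eLpNorm_le (hΩ : IsOpen Ω) {N : ℝ → ℝ → ℝ} (hN : Continuous (Function.uncurry N))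
    {p : ENNReal}
    (H : ∀ (φ : E → ℝ) (h : IsTestFunction Ω φ),
      eLpNorm φ p (volume.restrict Ω) ≤ ENNReal.ofReal (N ‖h.toL2‖ (gradNorm e Ω h.toL2)))
    {f : L2 Ω} (hf : MemW120 e Ω f) :
    eLpNorm f p (volume.restrict Ω) ≤ ENNReal.ofReal (N ‖f‖ (gradNorm e Ω f)) := by
  obtain ⟨φ, hφ⟩ := hf.exists_approx hΩ
  -- A subsequence converges almost everywhere, and Fatou's lemma gives lower semicontinuity of the
  -- $L^p$ norm along it. Finiteness of that norm for `f` is thus a conclusion.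
  obtain ⟨ns, hns, hae⟩ := (tendstoInMeasure_of_tendsto_Lp hφ.tendsto).exists_seq_tendsto_ae
  have hG : Tendsto (fun n => gradNorm e Ω (hφ.test n).toL2) atTop (𝓝 (gradNorm e Ω f)) := by
    unfold gradNorm
    simp only [(hφ.test _).weakDeriv_toL2 hΩ]
    exact (tendsto_finsetSum _ fun i _ => (hφ.tendsto_deriv i).norm.pow 2).sqrt
  have hlim : Tendsto (fun n => ENNReal.ofReal
      (N ‖(hφ.test (ns n)).toL2‖ (gradNorm e Ω (hφ.test (ns n)).toL2))) atTop
      (𝓝 (ENNReal.ofReal (N ‖f‖ (gradNorm e Ω f)))) :=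
    ENNReal.tendsto_ofReal (((hN.tendsto (‖f‖, gradNorm e Ω f)).comp
      (hφ.tendsto.norm.prodMk_nhds hG)).comp hns.tendsto_atTop)
  calc eLpNorm f p (volume.restrict Ω)
      ≤ atTop.liminf fun n => eLpNorm ((hφ.test (ns n)).toL2) p (volume.restrict Ω) :=
        Lp.eLpNorm_lim_le_liminf_eLpNorm (fun n => Lp.aestronglyMeasurable _) _ hae
    _ ≤ atTop.liminf fun n => ENNReal.ofReal
        (N ‖(hφ.test (ns n)).toL2‖ (gradNorm e Ω (hφ.test (ns n)).toL2)) :=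
        liminf_le_liminf (.of_forall fun n => by
          simp only [eLpNorm_congr_ae (hφ.test (ns n)).coeFn_toL2]
          exact H _ _)
    _ = _ := hlim.liminf_eq

theorem norm_le_sum_e2 (L : R2 →L[ℝ] ℝ) : ‖L‖ ≤ ∑ i, ‖L (e2 i)‖ := by
  refine L.opNorm_le_bound (by positivity) fun x => ?_
  have hx : x = ∑ i, x i • e2 i := by
    ext j
    fin_cases j <;> simp [e2]
  conv_lhs => rw [hx, map_sum]
  rw [Finset.sum_mul]
  refine norm_sum_le_of_le _ fun i _ => ?_
  rw [map_smul, norm_smul, mul_comm]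
  exact mul_le_mul_of_nonneg_left (PiLp.norm_apply_le x i) (norm_nonneg _)

/-- `R3` carries the maximum norm of the product; both factors of a point are bounded by it, so the
constant is still one. -/
theorem norm_le_sum_e3 (L : R3 →L[ℝ] ℝ) : ‖L‖ ≤ ∑ i, ‖L (e3 i)‖ := by
  refine L.opNorm_le_bound (by positivity) fun x => ?_
  have h2 := (norm_le_sum_e2 (L.comp (ContinuousLinearMap.inl ℝ R2 ℝ)))
  have h1 : L x = L (x.1, 0) + x.2 * L (0, 1) := by
    rw [← smul_eq_mul, ← map_smul, ← map_add]
    simp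
  have h3 : ‖L (x.1, 0)‖ ≤ (∑ i, ‖L (e2 i, 0)‖) * ‖x.1‖ :=
    (((L.comp (ContinuousLinearMap.inl ℝ R2 ℝ))).le_opNorm x.1).trans
      (mul_le_mul_of_nonneg_right (by simpa using h2) (norm_nonneg _))
  calc ‖L x‖ ≤ ‖L (x.1, 0)‖ + ‖x.2‖ * ‖L (0, 1)‖ := by
        rw [h1, ← norm_mul]; exact norm_add_le _ _
    _ ≤ (∑ i, ‖L (e2 i, 0)‖) * ‖x‖ + ‖x‖ * ‖L (0, 1)‖ := by
        gcongr
        · exact h3.trans (mul_le_mul_of_nonneg_left (norm_fst_le x) (by positivity))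
        · exact norm_snd_le x
    _ = (∑ i, ‖L (e3 i)‖) * ‖x‖ := by
        simp [e3, Fin.sum_univ_three, Fin.sum_univ_two]
        ring

/-- Ladyzhenskaya's inequality in the plane. -/
theorem exists_eLpNorm_four_le_R2 {D : Set R2} (hD : IsOpen D) :
    ∃ C ≥ (0 : ℝ), ∀ f : L2 D, MemW120 e2 D f →
      eLpNorm f 4 (volume.restrict D) ≤ ENNReal.ofReal (√(C * (‖f‖ * gradNorm e2 D f))) := by
  set K : NNReal := eLpNormLESNormFDerivOneConst (volume : Measure R2) 2
  -- One factor 2 comes from $\nabla(\varphi^2)=2\varphi\nabla\varphi$, the other from the two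
  -- partial derivatives in `eLpNorm_fderiv_le`.
  refine ⟨K * 2 * 2, by positivity, fun f hf => ?_⟩
  refine MemW120.eLpNorm_le (N := fun a b => √(K * 2 * 2 * (a * b))) hD
    (by unfold Function.uncurry; fun_prop) (fun φ h => ?_) hf
  have hc : NNReal.HolderConjugate (Module.finrank ℝ R2) 2 := by
    simp only [finrank_euclideanSpace, Fintype.card_fin, Nat.cast_ofNat]
    exact (NNReal.holderConjugate_iff).2 ⟨by norm_num, by
      rw [← two_mul]; exact mul_inv_cancel₀ (by norm_num)⟩
  -- The embedding $W^{1,1}\subset L^2$ of the plane is applied to $\varphi^2$: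
  -- $\|\varphi\|_4^2=\|\varphi^2\|_2\le K\|\nabla(\varphi^2)\|_1$, and Cauchy–Schwarz splits the
  -- last norm.
  have hφ2 := h.mul h.1
  have hgns := eLpNorm_le_eLpNorm_fderiv_one (volume : Measure R2) (u := fun x => φ x * φ x)
    (hφ2.1.of_le (by simp)) hφ2.2.1 hc
  have hsq : eLpNorm (fun x => φ x * φ x) (2 : NNReal) (volume : Measure R2)
      = eLpNorm φ 4 volume ^ 2 := by
    have h4 : ((4 : NNReal) : ENNReal) = 4 := by norm_num
    have h2 : ((2 : NNReal) : ENNReal) = 2 := by norm_num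
    rw [← h4, h2, eLpNorm_nnreal_eq_eLpNorm' (by norm_num), eLpNorm_eq_eLpNorm' (by norm_num)
      (by norm_num), eLpNorm', eLpNorm', ← ENNReal.rpow_natCast, ← ENNReal.rpow_mul]
    congr 1
    · refine lintegral_congr fun x => ?_
      rw [enorm_mul, ENNReal.mul_rpow_of_nonneg _ _ (by norm_num), ← ENNReal.rpow_add_of_nonneg _ _
        (by norm_num) (by norm_num)]
      norm_num
    · norm_num
  have hfd : eLpNorm (fderiv ℝ (fun x => φ x * φ x)) 1 (volume : Measure R2)
      ≤ 2 * eLpNorm φ 2 volume * eLpNorm (fderiv ℝ φ) 2 volume := by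
    have h1 : fderiv ℝ (fun x => φ x * φ x) = fun x => (2 * φ x) • fderiv ℝ φ x := by
      funext x
      rw [fderiv_fun_mul (h.differentiable x) (h.differentiable x), ← add_smul, two_mul]
    rw [h1]
    have h2 := eLpNorm_le_eLpNorm_mul_eLpNorm_of_nnnorm (p := 2) (q := 2) (r := 1)
      (h.memLp_volume 2).1 ((h.1.continuous_fderiv (by simp)).aestronglyMeasurable)
      (fun (a : ℝ) (L : R2 →L[ℝ] ℝ) => (2 * a) • L) 2 (μ := (volume : Measure R2))
      (.of_forall fun x => by
        rw [nnnorm_smul, nnnorm_mul]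
        simp)
    simpa using h2
  rw [h.eLpNorm_restrict]
  have hfin : eLpNorm φ 4 volume ^ 2
      ≤ ENNReal.ofReal (K * 2 * 2 * (‖h.toL2‖ * gradNorm e2 D h.toL2)) := by
    rw [← hsq]
    refine hgns.trans ?_
    calc (K : ENNReal) * eLpNorm (fderiv ℝ (fun x => φ x * φ x)) 1 (volume : Measure R2)
        ≤ K * (2 * eLpNorm φ 2 volume * eLpNorm (fderiv ℝ φ) 2 volume) := by gcongr
      _ ≤ K * (2 * ENNReal.ofReal ‖h.toL2‖ * ENNReal.ofReal (2 * gradNorm e2 D h.toL2)) := by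
          gcongr
          · exact h.eLpNorm_two.le
          · simpa using h.eLpNorm_fderiv_le hD norm_le_sum_e2
      _ = ENNReal.ofReal (K * 2 * 2 * (‖h.toL2‖ * gradNorm e2 D h.toL2)) := by
          have hK : (K : ENNReal) = ENNReal.ofReal K := by simp
          have h2 (x : ℝ) : 2 * ENNReal.ofReal x = ENNReal.ofReal (2 * x) := by
            rw [ENNReal.ofReal_mul (by norm_num), ENNReal.ofReal_ofNat]
          rw [hK, h2, ← ENNReal.ofReal_mul (by positivity),
            ← ENNReal.ofReal_mul (by positivity)]
          congr 1
          ring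
  rw [Real.sqrt_eq_rpow, ← ENNReal.ofReal_rpow_of_nonneg
    (mul_nonneg (by positivity) (mul_nonneg (norm_nonneg _) (gradNorm_nonneg _))) (by norm_num)]
  calc eLpNorm φ 4 volume = (eLpNorm φ 4 volume ^ 2) ^ (1 / 2 : ℝ) := by
        rw [← ENNReal.rpow_natCast, ← ENNReal.rpow_mul]; norm_num
    _ ≤ _ := by gcongr

instance : (volume : Measure R3).IsAddHaarMeasure :=
  inferInstanceAs (((volume : Measure R2).prod (volume : Measure ℝ)).IsAddHaarMeasure)

/-- The condition `hq` says $q\le 6$, the critical exponent of $W^{1,2}$ in dimension three;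
boundedness of the set gives the smaller exponents. The case $q=4$ serves the trilinear terms and
$q=2$ is Poincaré's inequality. -/
theorem exists_eLpNorm_le_R3 {Ω : Set R3} (hΩ : IsOpen Ω) (hb : Bornology.IsBounded Ω)
    {q : NNReal} (hq : (1 / 6 : ℝ) ≤ (q : ℝ)⁻¹) :
    ∃ C ≥ (0 : ℝ), ∀ f : L2 Ω, MemW120 e3 Ω f →
      eLpNorm f q (volume.restrict Ω) ≤ ENNReal.ofReal (C * gradNorm e3 Ω f) := by
  set K : NNReal := eLpNormLESNormFDerivOfLeConst ℝ (volume : Measure R3) Ω 2 q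
  refine ⟨K * 3, by positivity, fun f hf => ?_⟩
  refine MemW120.eLpNorm_le (N := fun a b => K * 3 * b) hΩ
    (by unfold Function.uncurry; fun_prop) (fun φ h => ?_) hf
  rw [h.eLpNorm_restrict]
  have h3 : Module.finrank ℝ R3 = 3 := by simp [R3]
  have hgns := eLpNorm_le_eLpNorm_fderiv_of_le (F := ℝ) (volume : Measure R3) (u := φ) (s := Ω)
    (p := 2) (q := q) (h.1.of_le (by simp)) (fun x hx => h.2.2 (subset_tsupport φ hx))
    (by norm_num) (by rw [h3]; norm_num) (by rw [h3]; norm_num at hq ⊢; linarith) hb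
  refine hgns.trans ?_
  have := h.eLpNorm_fderiv_le hΩ norm_le_sum_e3
  rw [mul_assoc, ENNReal.ofReal_mul (by positivity), ENNReal.ofReal_coe_nnreal]
  gcongr
  simpa using this

end Embedding

/-! ### Trilinear integrals with exponents 4, 2, 4 -/

instance : ENNReal.HolderTriple 4 4 2 where
  inv_add_inv_eq_inv := by
    have h : (4 : ENNReal) = 2 * 2 := by norm_num
    rw [h, ENNReal.mul_inv (by simp) (by simp), ← mul_add, ENNReal.inv_two_add_inv_two, mul_one]

section Trilinear

variable {X : Type} [MeasureSpace X] {S : Set X} {b h : X → ℝ}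

theorem integral_mul_L2 (hb : MemLp b 2 (volume.restrict S)) (g : L2 S) :
    ∫ x in S, b x * g x = inner ℝ (hb.toLp b) g := by
  rw [inner_L2]
  refine integral_congr_ae ?_
  filter_upwards [hb.coeFn_toLp] with x hx using by rw [hx]

/-- The two $L^4$ factors multiply to an $L^2$ function, so bounds and limits reduce to those of an
inner product with the derivative `g`. -/
theorem integral_trilinear (hb : MemLp b 4 (volume.restrict S))
    (hh : MemLp h 4 (volume.restrict S)) (g : L2 S) :
    ∫ x in S, b x * g x * h x = inner ℝ ((hh.mul' hb (r := 2)).toLp _) g := by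
  rw [← integral_mul_L2]
  exact integral_congr_ae (.of_forall fun x => by ring)

theorem integrable_trilinear (hb : MemLp b 4 (volume.restrict S))
    (hh : MemLp h 4 (volume.restrict S)) (g : L2 S) :
    Integrable (fun x => b x * g x * h x) (volume.restrict S) :=
  ((hh.mul' hb (r := 2)).integrable_mul (Lp.memLp g)).congr
    (.of_forall fun x => by simp only [Pi.mul_apply]; ring)

theorem norm_toLp_mul_le (hb : MemLp b 4 (volume.restrict S))
    (hh : MemLp h 4 (volume.restrict S)) :
    ‖(hh.mul' hb (r := 2)).toLp _‖
      ≤ (eLpNorm b 4 (volume.restrict S)).toReal * (eLpNorm h 4 (volume.restrict S)).toReal := by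
  have h1 : eLpNorm (fun x => b x * h x) 2 (volume.restrict S)
      ≤ eLpNorm b 4 (volume.restrict S) * eLpNorm h 4 (volume.restrict S) := by
    simpa using eLpNorm_le_eLpNorm_mul_eLpNorm_of_nnnorm (p := 4) (q := 4) (r := 2) hb.1 hh.1
      (fun a c : ℝ => a * c) 1 (.of_forall fun x => by simp)
  rw [Lp.norm_toLp, ← ENNReal.toReal_mul]
  exact ENNReal.toReal_mono (ENNReal.mul_ne_top hb.eLpNorm_ne_top hh.eLpNorm_ne_top) h1

theorem abs_integral_trilinear_le (hb : MemLp b 4 (volume.restrict S))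
    (hh : MemLp h 4 (volume.restrict S)) (g : L2 S) :
    |∫ x in S, b x * g x * h x| ≤ (eLpNorm b 4 (volume.restrict S)).toReal
      * (eLpNorm h 4 (volume.restrict S)).toReal * ‖g‖ := by
  rw [integral_trilinear hb hh]
  exact (abs_real_inner_le_norm _ _).trans
    (mul_le_mul_of_nonneg_right (norm_toLp_mul_le hb hh) (norm_nonneg _))

theorem tendsto_trilinear (hb : MemLp b 4 (volume.restrict S)) {g : ℕ → L2 S} {g₀ : L2 S}
    (hg : Tendsto g atTop (𝓝 g₀)) {h : ℕ → X → ℝ} {h₀ : X → ℝ}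
    (hh : ∀ n, MemLp (h n) 4 (volume.restrict S)) (hh₀ : MemLp h₀ 4 (volume.restrict S))
    (hlim : Tendsto (fun n => eLpNorm (h n - h₀) 4 (volume.restrict S)) atTop (𝓝 0)) :
    Tendsto (fun n => ∫ x in S, b x * g n x * h n x) atTop
      (𝓝 (∫ x in S, b x * g₀ x * h₀ x)) := by
  simp only [integral_trilinear hb hh₀, integral_trilinear hb (hh _)]
  refine Tendsto.inner ?_ hg
  rw [tendsto_iff_norm_sub_tendsto_zero]
  have hlim' := (ENNReal.tendsto_toReal ENNReal.zero_ne_top).comp hlim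
  refine squeeze_zero (fun _ => norm_nonneg _) (fun n => ?_)
    (by simpa using hlim'.const_mul (eLpNorm b 4 (volume.restrict S)).toReal)
  have : ((hh n).mul' hb (r := 2)).toLp _ - (hh₀.mul' hb (r := 2)).toLp _
      = (((hh n).sub hh₀).mul' hb (r := 2)).toLp _ := by
    rw [← MemLp.toLp_sub]
    congr 1
    funext x
    simp [mul_sub]
  rw [this]
  exact norm_toLp_mul_le hb ((hh n).sub hh₀)

end Trilinear

/-! ### Transport terms on $W^{1,2}_0$ -/

section Embedding

variable {E : Type} [NormedAddCommGroup E] [NormedSpace ℝ E] [MeasureSpace E] [BorelSpace E]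
  [FiniteDimensional ℝ E] [(volume : Measure E).IsAddHaarMeasure]
  {ι : Type} [Fintype ι] {Ω : Set E} {e : ι → E}

/-- `W^{1,2}_0(Ω)` embeds continuously into `L⁴(Ω)`. -/
def EmbedsL4 (e : ι → E) (Ω : Set E) : Prop :=
  ∃ C : ℝ, ∀ f : L2 Ω, MemW120 e Ω f →
    eLpNorm f 4 (volume.restrict Ω) ≤ ENNReal.ofReal (C * w12Norm e Ω f)

theorem EmbedsL4.memLp (H : EmbedsL4 e Ω) {f : L2 Ω} (hf : MemW120 e Ω f) :
    MemLp f 4 (volume.restrict Ω) := by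
  obtain ⟨C, hC⟩ := H
  exact ⟨Lp.aestronglyMeasurable f, (hC f hf).trans_lt ENNReal.ofReal_lt_top⟩

theorem EmbedsL4.tendsto (H : EmbedsL4 e Ω) (hΩ : IsOpen Ω) {f : L2 Ω} (hf : MemW120 e Ω f)
    {φ : ℕ → E → ℝ} (hφ : W12Approx e f φ) :
    Tendsto (fun n => eLpNorm (φ n - (f : E → ℝ)) 4 (volume.restrict Ω)) atTop (𝓝 0) := by
  obtain ⟨C, hC⟩ := H
  have h0 := ENNReal.tendsto_ofReal ((hφ.tendsto_w12Norm hΩ hf.1).const_mul C)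
  rw [mul_zero, ENNReal.ofReal_zero] at h0
  refine tendsto_of_tendsto_of_tendsto_of_le_of_le tendsto_const_nhds h0
    (fun _ => zero_le) fun n => ?_
  refine le_trans (le_of_eq ?_) (hC _ (hf.sub hΩ ((hφ.test n).memW120 hΩ)))
  rw [eLpNorm_sub_comm]
  refine eLpNorm_congr_ae ?_
  filter_upwards [Lp.coeFn_sub f (hφ.test n).toL2, (hφ.test n).coeFn_toL2] with x h1 h2
  rw [h1, Pi.sub_apply, Pi.sub_apply, h2]

/-- The trilinear form `∫ (b · ∇ f) h` is continuous in `f` and `h`. -/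
theorem EmbedsL4.tendsto_trilinear (H : EmbedsL4 e Ω) (hΩ : IsOpen Ω) {b : E → ℝ}
    (hb : MemLp b 4 (volume.restrict Ω)) {g : ℕ → L2 Ω} {g₀ : L2 Ω}
    (hg : Tendsto g atTop (𝓝 g₀)) {z : L2 Ω} (hz : MemW120 e Ω z)
    {φ : ℕ → E → ℝ} (hφ : W12Approx e z φ) :
    Tendsto (fun n => ∫ x in Ω, b x * g n x * φ n x) atTop (𝓝 (∫ x in Ω, b x * g₀ x * z x)) :=
  ROB.tendsto_trilinear hb hg (fun n => (hφ.test n).memLp 4) (H.memLp hz) (H.tendsto hΩ hz hφ)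

/-- Transport by a divergence free field conserves the energy. -/
theorem EmbedsL4.sum_integral_eq_zero (H : EmbedsL4 e Ω) (hΩ : IsOpen Ω) {τ : Type} [Fintype τ]
    (σ : τ → ι) {b : τ → E → ℝ} (hb : ∀ j, MemLp (b j) 4 (volume.restrict Ω))
    (hdiv : ∀ φ, IsTestFunction Ω φ →
      ∑ j, ∫ x in Ω, b j x * fderiv ℝ φ x (e (σ j)) * φ x = 0)
    {z : L2 Ω} (hz : MemW120 e Ω z) :
    ∑ j, ∫ x in Ω, b j x * weakDeriv Ω (e (σ j)) z x * z x = 0 := by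
  obtain ⟨φ, hφ⟩ := hz.exists_approx hΩ
  refine tendsto_nhds_unique (tendsto_finsetSum _ fun j _ =>
    H.tendsto_trilinear hΩ (hb j) (hφ.tendsto_deriv (σ j)) hz hφ) ?_
  refine tendsto_const_nhds.congr fun n => ?_
  rw [← hdiv (φ n) (hφ.test n)]
  refine Finset.sum_congr rfl fun j _ => integral_congr_ae ?_
  filter_upwards [((hφ.test n).fderiv (e (σ j))).coeFn_toL2] with x hx using by rw [hx]

theorem embedsL4_R2 {D : Set R2} (hD : IsOpen D) : EmbedsL4 e2 D := by
  obtain ⟨C, hC0, hC⟩ := exists_eLpNorm_four_le_R2 hD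
  refine ⟨√C, fun f hf => (hC f hf).trans (ENNReal.ofReal_le_ofReal ?_)⟩
  rw [Real.sqrt_mul hC0]
  refine mul_le_mul_of_nonneg_left ?_ (Real.sqrt_nonneg _)
  refine Real.sqrt_le_iff.2 ⟨Real.sqrt_nonneg _, ?_⟩
  rw [w12Norm_sq]
  nlinarith [sq_nonneg (‖f‖ - gradNorm e2 D f), sq_nonneg (‖f‖), sq_nonneg (gradNorm e2 D f)]

theorem embedsL4_R3 {Ω : Set R3} (hΩ : IsOpen Ω) (hb : Bornology.IsBounded Ω) :
    EmbedsL4 e3 Ω := by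
  obtain ⟨C, hC0, hC⟩ := exists_eLpNorm_le_R3 hΩ hb (q := 4) (by norm_num)
  exact ⟨C, fun f hf => (hC f hf).trans (ENNReal.ofReal_le_ofReal
    (mul_le_mul_of_nonneg_left (gradNorm_le_w12Norm f) hC0))⟩

end Embedding

/-- Transport by a divergence free field in the plane conserves the energy. -/
theorem sum_integral_transport_R2 {D : Set R2} (hD : IsOpen D) {U : L2v D}
    (hU : ∀ i, MemW120 e2 D (U i)) (hdiv : ∑ i, weakDeriv D (e2 i) (U i) = 0) {z : L2 D}
    (hz : MemW120 e2 D z) :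
    ∑ j, ∫ x in D, U j x * weakDeriv D (e2 j) z x * z x = 0 := by
  refine (embedsL4_R2 hD).sum_integral_eq_zero hD id
    (fun j => (embedsL4_R2 hD).memLp (hU j)) (fun φ hφ => ?_) hz
  have hφ2 := hφ.mul hφ.1
  -- Since $\varphi\,\partial_j\varphi=\frac12\partial_j(\varphi^2)$, the derivative moves to $U_j$;
  -- summation over $j$ produces the divergence.
  have h1 (j : Fin 2) : ∫ x in D, U j x * fderiv ℝ φ x (e2 j) * φ x
      = -(1 / 2) * inner ℝ (weakDeriv D (e2 j) (U j)) hφ2.toL2 := by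
    have h2 := (hU j).1.hasWeakDeriv j
    rw [hasWeakDeriv_iff] at h2
    have h3 := h2 _ hφ2
    rw [(hφ2.fderiv (e2 j)).inner_toL2] at h3
    have h4 : ∫ x in D, U j x * fderiv ℝ (fun x => φ x * φ x) x (e2 j)
        = 2 * ∫ x in D, U j x * fderiv ℝ φ x (e2 j) * φ x := by
      rw [← integral_const_mul]
      refine integral_congr_ae (.of_forall fun x => ?_)
      simp only [fderiv_fun_mul (hφ.differentiable x) (hφ.differentiable x),
        add_apply, smul_apply, smul_eq_mul]
      ring
    linarith
  simp only [id, h1]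
  rw [← Finset.mul_sum, ← sum_inner, hdiv, inner_zero_left, mul_zero]

/-! ### Horizontal fields acting on functions in the cylinder -/

section Cylinder

variable {D : Set R2}

theorem isOpen_cyl (hD : IsOpen D) : IsOpen (cyl D) := hD.prod isOpen_Ioo

theorem isBounded_cyl (hD : Bornology.IsBounded D) : Bornology.IsBounded (cyl D) :=
  hD.prod (Metric.isBounded_Ioo 0 1)

theorem volume_restrict_cyl :
    (volume : Measure R3).restrict (cyl D)
      = (volume.restrict D).prod (volume.restrict (Ioo (0 : ℝ) 1)) := by
  rw [cyl, Measure.prod_restrict, Measure.volume_eq_prod]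

instance : IsProbabilityMeasure ((volume : Measure ℝ).restrict (Ioo (0 : ℝ) 1)) :=
  ⟨by simp⟩

/-- The vertical section has length one, so horizontal functions lift isometrically and no constant
appears below. -/
theorem measurePreserving_fst_cyl : MeasurePreserving (Prod.fst : R3 → R2)
    (volume.restrict (cyl D)) (volume.restrict D) := by
  rw [volume_restrict_cyl]
  exact measurePreserving_fst

/-- Functions of the horizontal variable as functions on the cylinder. -/
noncomputable def liftL2 (D : Set R2) : L2 D →ₗᵢ[ℝ] L2 (cyl D) :=
  Lp.compMeasurePreservingₗᵢ ℝ Prod.fst measurePreserving_fst_cyl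

theorem coeFn_liftL2 (f : L2 D) :
    liftL2 D f =ᵐ[volume.restrict (cyl D)] fun x => f x.1 :=
  Lp.coeFn_compMeasurePreserving f measurePreserving_fst_cyl

theorem inner_liftL2 (f : L2 D) (h : L2 (cyl D)) :
    inner ℝ (liftL2 D f) h = ∫ x in cyl D, f x.1 * h x := by
  rw [inner_L2]
  refine integral_congr_ae ?_
  filter_upwards [coeFn_liftL2 f] with x hx using by rw [hx]

theorem e3_castSucc (j : Fin 2) : e3 j.castSucc = (e2 j, 0) := by
  fin_cases j <;> rfl

/-- The vertical average is the adjoint of the lift. -/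
theorem integral_vAvg_mul (Θ : L2 (cyl D)) (k : L2 D) :
    Integrable (fun x => vAvg Θ x * k x) (volume.restrict D) ∧
      ∫ x in D, vAvg Θ x * k x = inner ℝ Θ (liftL2 D k) := by
  have hint : Integrable (fun x : R3 => Θ x * k x.1)
      ((volume.restrict D).prod (volume.restrict (Ioo (0 : ℝ) 1))) := by
    rw [← volume_restrict_cyl]
    refine ((Lp.memLp Θ).integrable_mul (Lp.memLp (liftL2 D k))).congr ?_
    filter_upwards [coeFn_liftL2 k] with x hx
    rw [Pi.mul_apply, hx]
  have hs (x : R2) : ∫ s in Ioo (0 : ℝ) 1, Θ (x, s) * k x = vAvg Θ x * k x := by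
    rw [vAvg, intervalIntegral.integral_of_le zero_le_one, integral_Ioc_eq_integral_Ioo,
      integral_mul_const]
  refine ⟨by simpa only [hs] using hint.integral_prod_left, ?_⟩
  rw [real_inner_comm, inner_liftL2]
  have h2 : ∫ x in cyl D, k x.1 * Θ x = ∫ x : R3, Θ x * k x.1
      ∂((volume.restrict D).prod (volume.restrict (Ioo (0 : ℝ) 1))) := by
    rw [← volume_restrict_cyl]
    exact integral_congr_ae (.of_forall fun x => mul_comm _ _)
  rw [h2, integral_prod _ hint]
  simp only [hs]

theorem memLp_comp_fst {f : R2 → ℝ} {p : ENNReal} (hf : MemLp f p (volume.restrict D)) :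
    MemLp (fun x : R3 => f x.1) p (volume.restrict (cyl D)) :=
  hf.comp_measurePreserving measurePreserving_fst_cyl

/-- A lifted horizontal function need not vanish at the top and bottom; the factor `φ` supplies the
missing vertical cutoff. -/
theorem IsTestFunction.comp_fst_mul {φ : R3 → ℝ} (hφ : IsTestFunction (cyl D) φ) {ψ : R2 → ℝ}
    (hψ : IsTestFunction D ψ) : IsTestFunction (cyl D) (fun x => φ x * ψ x.1) :=
  hφ.mul (hψ.1.comp contDiff_fst)

theorem fderiv_mul_comp_fst {φ : R3 → ℝ} (hφ : IsTestFunction (cyl D) φ) {ψ : R2 → ℝ}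
    (hψ : IsTestFunction D ψ) (x : R3) (v : R2) :
    fderiv ℝ (fun x : R3 => φ x * ψ x.1) x (v, 0)
      = φ x * fderiv ℝ ψ x.1 v + fderiv ℝ φ x (v, 0) * ψ x.1 := by
  have h1 : HasFDerivAt (fun x : R3 => ψ x.1)
      ((fderiv ℝ ψ x.1).comp (ContinuousLinearMap.fst ℝ R2 ℝ)) x :=
    (hψ.differentiable x.1).hasFDerivAt.comp x (ContinuousLinearMap.fst ℝ R2 ℝ).hasFDerivAt
  rw [((hφ.differentiable x).hasFDerivAt.fun_mul h1).fderiv]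
  simp [mul_comm]

/-- The product of an `L²` function with a test function. -/
noncomputable def IsTestFunction.mulL2 {φ : R3 → ℝ} (hφ : IsTestFunction (cyl D) φ)
    (f : L2 (cyl D)) : L2 (cyl D) :=
  ((Lp.memLp f).mul' (hφ.memLp ⊤) (r := 2)).toLp (fun x => φ x * f x)

theorem IsTestFunction.coeFn_mulL2 {φ : R3 → ℝ} (hφ : IsTestFunction (cyl D) φ)
    (f : L2 (cyl D)) : hφ.mulL2 f =ᵐ[volume.restrict (cyl D)] fun x => φ x * f x :=
  MemLp.coeFn_toLp _

/-- The product rule tested with `φ`, for the product of `f` with a horizontal function. -/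
theorem inner_liftL2_mulL2 (hD : IsOpen D) {j : Fin 2} {f g : L2 (cyl D)}
    (hf : HasWeakDeriv (cyl D) (e2 j, 0) f g) {w : L2 D} (hw : MemW120 e2 D w)
    {φ : R3 → ℝ} (hφ : IsTestFunction (cyl D) φ) :
    inner ℝ (liftL2 D w) (hφ.mulL2 g) = - inner ℝ (liftL2 D (weakDeriv D (e2 j) w)) (hφ.mulL2 f)
      - inner ℝ (liftL2 D w) ((hφ.fderiv (e2 j, 0)).mulL2 f) := by
  -- As `w` is not smooth, $\varphi w$ is not a test function. With `w` replaced by `ψ n` it is one,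
  -- and each term is continuous in `w` and $\partial_j w$ for the $L^2$ norm.
  obtain ⟨ψ, hψ⟩ := hw.exists_approx hD
  have hl : Tendsto (fun n => liftL2 D (hψ.test n).toL2) atTop (𝓝 (liftL2 D w)) :=
    ((liftL2 D).continuous.tendsto w).comp hψ.tendsto
  have hl' : Tendsto (fun n => liftL2 D ((hψ.test n).fderiv (e2 j)).toL2) atTop
      (𝓝 (liftL2 D (weakDeriv D (e2 j) w))) :=
    ((liftL2 D).continuous.tendsto _).comp (hψ.tendsto_deriv j)
  refine tendsto_nhds_unique (hl.inner tendsto_const_nhds)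
    (((hl'.inner tendsto_const_nhds).neg.sub (hl.inner tendsto_const_nhds)).congr fun n => ?_)
  have h := hf _ (hφ.comp_fst_mul (hψ.test n))
  have key {χ : R2 → ℝ} (hχ : IsTestFunction D χ) {θ : R3 → ℝ} (hθ : IsTestFunction (cyl D) θ)
      (k : L2 (cyl D)) : (fun x => liftL2 D hχ.toL2 x * hθ.mulL2 k x)
        =ᵐ[volume.restrict (cyl D)] fun x => k x * (θ x * χ x.1) := by
    filter_upwards [coeFn_liftL2 hχ.toL2, hθ.coeFn_mulL2 k,
      (measurePreserving_fst_cyl (D := D)).quasiMeasurePreserving.ae_eq_comp hχ.coeFn_toL2]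
      with x h1 h2 h3
    rw [h1, h2, show hχ.toL2 x.1 = χ x.1 from h3]
    ring
  have hi (p q : L2 (cyl D)) : Integrable (fun x => p x * q x) (volume.restrict (cyl D)) :=
    (Lp.memLp p).integrable_mul (Lp.memLp q)
  rw [inner_L2, inner_L2, inner_L2, integral_congr_ae (key (hψ.test n) hφ g)]
  have hsum : ∫ x in cyl D, f x * fderiv ℝ (fun x : R3 => φ x * ψ n x.1) x (e2 j, 0)
      = (∫ x in cyl D, liftL2 D ((hψ.test n).fderiv (e2 j)).toL2 x * hφ.mulL2 f x)
        + ∫ x in cyl D, liftL2 D (hψ.test n).toL2 x * (hφ.fderiv (e2 j, 0)).mulL2 f x := by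
    rw [← integral_add (hi _ _) (hi _ _)]
    refine integral_congr_ae ?_
    filter_upwards [key ((hψ.test n).fderiv (e2 j)) hφ f,
      key (hψ.test n) (hφ.fderiv (e2 j, 0)) f] with x h1 h2
    rw [h1, h2, fderiv_mul_comp_fst hφ (hψ.test n)]
    ring
  rw [hsum] at h
  linarith

variable {W : L2v D}

/-- The terms with $\partial_jW_j$ share the factor $\varphi f$, so they add up to the divergence of
`W` and disappear. -/
theorem sum_inner_liftL2_mulL2 (hD : IsOpen D) {f : L2 (cyl D)} (hf : MemW12 e3 (cyl D) f)
    (hW : ∀ i, MemW120 e2 D (W i)) (hdiv : ∑ i, weakDeriv D (e2 i) (W i) = 0)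
    {φ : R3 → ℝ} (hφ : IsTestFunction (cyl D) φ) :
    ∑ j, inner ℝ (liftL2 D (W j)) (hφ.mulL2 (weakDeriv (cyl D) (e2 j, 0) f))
      = - ∑ j, inner ℝ (liftL2 D (W j)) ((hφ.fderiv (e2 j, 0)).mulL2 f) := by
  have h (j : Fin 2) : HasWeakDeriv (cyl D) (e2 j, 0) f (weakDeriv (cyl D) (e2 j, 0) f) := by
    simpa only [e3_castSucc] using hf.hasWeakDeriv j.castSucc
  simp only [fun j => inner_liftL2_mulL2 hD (h j) (hW j) hφ]
  rw [Finset.sum_sub_distrib, Finset.sum_neg_distrib, ← sum_inner, ← map_sum, hdiv]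
  simp

theorem inner_liftL2_mulL2_eq (w : L2 D) (f : L2 (cyl D)) {φ : R3 → ℝ}
    (hφ : IsTestFunction (cyl D) φ) :
    inner ℝ (liftL2 D w) (hφ.mulL2 f) = ∫ x in cyl D, w x.1 * f x * φ x := by
  rw [inner_liftL2]
  refine integral_congr_ae ?_
  filter_upwards [hφ.coeFn_mulL2 f] with x hx
  rw [hx]
  ring

/-- Transport by a divergence free horizontal field conserves the energy in the cylinder. -/
theorem sum_integral_transport_cyl (hD : IsOpen D) (hb : Bornology.IsBounded D)
    (hW : ∀ i, MemW120 e2 D (W i)) (hdiv : ∑ i, weakDeriv D (e2 i) (W i) = 0)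
    {z : L2 (cyl D)} (hz : MemW120 e3 (cyl D) z) :
    ∑ j : Fin 2, ∫ x in cyl D, W j x.1 * weakDeriv (cyl D) (e2 j, 0) z x * z x = 0 := by
  have H := (embedsL4_R3 (isOpen_cyl hD) (isBounded_cyl hb)).sum_integral_eq_zero (isOpen_cyl hD)
    Fin.castSucc (b := fun j x => W j x.1)
    (fun j => memLp_comp_fst ((embedsL4_R2 hD).memLp (hW j))) (fun φ hφ => ?_) hz
  · simpa only [e3_castSucc] using H
  -- For $f=\varphi$ the identity says that the transport integral equals its own negative.
  · have h := sum_inner_liftL2_mulL2 hD hφ.memW12 hW hdiv hφ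
    simp only [inner_liftL2_mulL2_eq, hφ.weakDeriv_toL2 (isOpen_cyl hD)] at h
    have h1 (j : Fin 2) :
        ∫ x in cyl D, W j x.1 * (hφ.fderiv (e2 j, 0)).toL2 x * φ x
          = ∫ x in cyl D, W j x.1 * fderiv ℝ φ x (e2 j, 0) * φ x := integral_congr_ae <| by
      filter_upwards [(hφ.fderiv (e2 j, 0)).coeFn_toL2] with x hx using by rw [hx]
    have h2 (j : Fin 2) :
        ∫ x in cyl D, W j x.1 * hφ.toL2 x * fderiv ℝ φ x (e2 j, 0)
          = ∫ x in cyl D, W j x.1 * fderiv ℝ φ x (e2 j, 0) * φ x := integral_congr_ae <| by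
      filter_upwards [hφ.coeFn_toL2] with x hx
      rw [hx]
      ring
    simp only [h1, h2] at h
    simp only [e3_castSucc]
    linarith

/-- The transport term of a bounded function, tested with `z`. -/
theorem abs_sum_integral_transport_le (hD : IsOpen D) (hb : Bornology.IsBounded D)
    (hW : ∀ i, MemW120 e2 D (W i)) (hdiv : ∑ i, weakDeriv D (e2 i) (W i) = 0)
    {f : L2 (cyl D)} (hf : MemW12 e3 (cyl D) f) (hfb : MemLp f ⊤ (volume.restrict (cyl D)))
    {z : L2 (cyl D)} (hz : MemW120 e3 (cyl D) z) :
    |∑ j : Fin 2, ∫ x in cyl D, W j x.1 * weakDeriv (cyl D) (e2 j, 0) f x * z x|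
      ≤ 2 * (linfNorm (cyl D) f * ‖W‖ * gradNorm e3 (cyl D) z) := by
  obtain ⟨φ, hφ⟩ := hz.exists_approx (isOpen_cyl hD)
  have hm (j : Fin 2) : MemLp (fun x => f x * liftL2 D (W j) x) 2 (volume.restrict (cyl D)) :=
    (Lp.memLp (liftL2 D (W j))).mul' hfb (r := 2)
  -- The derivative moves from `f` to the approximants of `z`. On the left the limit uses their
  -- convergence in $L^4$. On the right boundedness of `f` puts $fW_j$ in $L^2$, so convergence of
  -- the gradients in $L^2$ suffices.
  have heq : ∑ j : Fin 2, ∫ x in cyl D, W j x.1 * weakDeriv (cyl D) (e2 j, 0) f x * z x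
      = - ∑ j : Fin 2, inner ℝ ((hm j).toLp _) (weakDeriv (cyl D) (e2 j, 0) z) := by
    have hL := tendsto_finsetSum Finset.univ fun (j : Fin 2) _ =>
      (embedsL4_R3 (isOpen_cyl hD) (isBounded_cyl hb)).tendsto_trilinear (isOpen_cyl hD)
        (b := fun x => W j x.1) (memLp_comp_fst ((embedsL4_R2 hD).memLp (hW j)))
        (tendsto_const_nhds (x := weakDeriv (cyl D) (e2 j, 0) f)) hz hφ
    have hR := tendsto_finsetSum Finset.univ fun (j : Fin 2) _ =>
      (tendsto_const_nhds (x := (hm j).toLp _)).inner (𝕜 := ℝ) (hφ.tendsto_deriv j.castSucc)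
    simp only [e3_castSucc] at hR
    refine tendsto_nhds_unique hL (hR.neg.congr fun n => ?_)
    have h := sum_inner_liftL2_mulL2 hD hf hW hdiv (hφ.test n)
    simp only [inner_liftL2_mulL2_eq] at h
    rw [h]
    refine congrArg Neg.neg (Finset.sum_congr rfl fun j _ => ?_)
    rw [IsTestFunction.inner_toL2]
    refine integral_congr_ae ?_
    filter_upwards [(hm j).coeFn_toLp, coeFn_liftL2 (W j)] with x h1 h2
    rw [h1, h2]
    ring
  rw [heq, abs_neg]
  have hj (j : Fin 2) : |inner ℝ ((hm j).toLp _) (weakDeriv (cyl D) (e2 j, 0) z)|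
      ≤ linfNorm (cyl D) f * ‖W‖ * gradNorm e3 (cyl D) z := by
    refine (abs_real_inner_le_norm _ _).trans ?_
    have h1 : ‖(hm j).toLp _‖ ≤ linfNorm (cyl D) f * ‖W‖ := by
      have h2 : eLpNorm (fun x => f x * liftL2 D (W j) x) 2 (volume.restrict (cyl D))
          ≤ eLpNorm f ⊤ (volume.restrict (cyl D))
            * eLpNorm (liftL2 D (W j)) 2 (volume.restrict (cyl D)) := by
        simpa using eLpNorm_le_eLpNorm_mul_eLpNorm_of_nnnorm (p := ⊤) (q := 2) (r := 2)
          hfb.1 (Lp.memLp (liftL2 D (W j))).1 (fun a c : ℝ => a * c) 1 (.of_forall fun x => by simp)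
      rw [Lp.norm_toLp]
      refine (ENNReal.toReal_mono (ENNReal.mul_ne_top hfb.eLpNorm_ne_top
        (Lp.eLpNorm_ne_top _)) h2).trans ?_
      rw [ENNReal.toReal_mul, ← Lp.norm_def, LinearIsometry.norm_map]
      exact mul_le_mul_of_nonneg_left (PiLp.norm_apply_le W j) ENNReal.toReal_nonneg
    have h3 : ‖weakDeriv (cyl D) (e2 j, 0) z‖ ≤ gradNorm e3 (cyl D) z := by
      simpa only [e3_castSucc] using norm_weakDeriv_le (e := e3) z j.castSucc
    exact mul_le_mul h1 h3 (norm_nonneg _)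
      (mul_nonneg ENNReal.toReal_nonneg (norm_nonneg _))
  refine (Finset.abs_sum_le_sum_abs _ _).trans ((Finset.sum_le_sum fun j _ => hj j).trans ?_)
  simp

end Cylinder

/-! ### Absolute continuity in time and exponential decay -/

section Time

variable {X : Type} [NormedAddCommGroup X] [NormedSpace ℝ X] {a b : ℝ}

theorem absolutelyContinuousOnInterval_of_dist_le {Y Z : Type*} [PseudoMetricSpace Y]
    [PseudoMetricSpace Z] {f : ℝ → Y} {g : ℝ → Z} {K : ℝ}
    (hf : AbsolutelyContinuousOnInterval f a b)
    (h : ∀ s ∈ uIcc a b, ∀ t ∈ uIcc a b, dist (g s) (g t) ≤ K * dist (f s) (f t)) :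
    AbsolutelyContinuousOnInterval g a b := by
  have h0 := Filter.Tendsto.const_mul K hf
  rw [mul_zero] at h0
  refine squeeze_zero' (.of_forall fun I => Finset.sum_nonneg fun i _ => dist_nonneg) ?_ h0
  filter_upwards [mem_inf_of_right (mem_principal_self _)] with I hI
  rw [Finset.mul_sum]
  exact Finset.sum_le_sum fun i hi => h _ (hI.1 i hi).1 _ (hI.1 i hi).2

theorem _root_.AbsolutelyContinuousOnInterval.inner_self {X : Type} [NormedAddCommGroup X]
    [InnerProductSpace ℝ X] {w : ℝ → X} (hw : AbsolutelyContinuousOnInterval w a b) :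
    AbsolutelyContinuousOnInterval (fun t => inner ℝ (w t) (w t)) a b := by
  have h : AbsolutelyContinuousOnInterval (fun t => ‖w t‖) a b :=
    absolutelyContinuousOnInterval_of_dist_le (K := 1) hw fun s _ t _ => by
      rw [one_mul, Real.dist_eq, dist_eq_norm]
      exact abs_norm_sub_norm_le _ _
  simpa only [real_inner_self_eq_norm_mul_norm] using h.fun_mul h

theorem _root_.AbsolutelyContinuousOnInterval.inner_const {X : Type} [NormedAddCommGroup X]
    [InnerProductSpace ℝ X] {w : ℝ → X} (hw : AbsolutelyContinuousOnInterval w a b) (c : X) :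
    AbsolutelyContinuousOnInterval (fun t => inner ℝ c (w t)) a b :=
  absolutelyContinuousOnInterval_of_dist_le (K := ‖c‖) hw fun s _ t _ => by
    rw [Real.dist_eq, dist_eq_norm, ← inner_sub_right]
    exact abs_real_inner_le_norm _ _

variable {J : Set ℝ} {w : ℝ → X}

theorem MemTimeW12.intervalIntegrable_deriv (hw : MemTimeW12 J w) (ha : a ∈ J) (hb : b ∈ J)
    (hab : a ≤ b) : IntervalIntegrable (deriv w) volume a b := by
  rw [intervalIntegrable_iff_integrableOn_Icc_of_le hab]
  exact ((hw a ha b hb hab).1.integrable (by norm_num))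

/-- The increments of `w` are dominated by those of the scalar function $t\mapsto\int_a^t\|w'\|$,
which is absolutely continuous. -/
theorem MemTimeW12.absolutelyContinuousOnInterval (hJ : J.OrdConnected) (hw : MemTimeW12 J w)
    (ha : a ∈ J) (hb : b ∈ J) (hab : a ≤ b) : AbsolutelyContinuousOnInterval w a b := by
  have hi := hw.intervalIntegrable_deriv ha hb hab
  have hV := hi.norm.absolutelyContinuousOnInterval_intervalIntegral (c := a) left_mem_uIcc
  have key : ∀ s ∈ Icc a b, ∀ t ∈ Icc a b, s ≤ t → dist (w s) (w t)
      ≤ 1 * dist (∫ r in a..s, ‖deriv w r‖) (∫ r in a..t, ‖deriv w r‖) := by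
    intro s hs t ht hst
    have hsub {c : ℝ} (hc : c ∈ Icc a b) : IntervalIntegrable (fun r => ‖deriv w r‖) volume a c :=
      hi.norm.mono_set (uIcc_subset_uIcc left_mem_uIcc (by rwa [uIcc_of_le hab]))
    rw [dist_comm, dist_eq_norm, (hw s (hJ.out ha hb hs) t (hJ.out ha hb ht) hst).2, one_mul,
      dist_comm, Real.dist_eq, intervalIntegral.integral_interval_sub_left (hsub ht) (hsub hs)]
    exact (intervalIntegral.norm_integral_le_integral_norm hst).trans (le_abs_self _)
  refine absolutelyContinuousOnInterval_of_dist_le (K := 1) hV fun s hs t ht => ?_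
  rw [uIcc_of_le hab] at hs ht
  rcases le_total s t with hst | hst
  · exact key s hs t ht hst
  · rw [dist_comm, dist_comm (∫ r in a..s, ‖deriv w r‖)]
    exact key t ht s hs hst

/-- `deriv` has a default value where there is no derivative. Lebesgue differentiation of $\int_a^t
w'$, which equals $w(t)-w(a)$, shows that it is a true derivative almost everywhere. -/
theorem MemTimeW12.ae_hasDerivAt [CompleteSpace X] (hJ : J.OrdConnected) (hw : MemTimeW12 J w)
    (ha : a ∈ J) (hb : b ∈ J) (hab : a ≤ b) :
    ∀ᵐ t, t ∈ Ioo a b → HasDerivAt w (deriv w t) t := by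
  filter_upwards [(hw.intervalIntegrable_deriv ha hb hab).ae_hasDerivAt_integral] with t ht hmem
  have h := (ht (by rw [uIcc_of_le hab]; exact Ioo_subset_Icc_self hmem) a left_mem_uIcc).add_const
    (w a)
  refine h.congr_of_eventuallyEq ?_
  filter_upwards [Ioo_mem_nhds hmem.1 hmem.2] with s hs
  rw [← (hw a ha s (hJ.out ha hb (Ioo_subset_Icc_self hs)) hs.1.le).2, sub_add_cancel]

/-- Exponential decay from a differential inequality for an absolutely continuous function. -/
theorem le_mul_exp_of_absolutelyContinuous {y y' : ℝ → ℝ} {β τ : ℝ} (hτ : 0 ≤ τ)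
    (hy : AbsolutelyContinuousOnInterval y 0 τ)
    (hd : ∀ᵐ t, t ∈ Ioo 0 τ → HasDerivAt y (y' t) t)
    (hle : ∀ᵐ t, t ∈ Ioo 0 τ → y' t ≤ -β * y t) :
    y τ ≤ y 0 * Real.exp (-β * τ) := by
  have hE : AbsolutelyContinuousOnInterval (fun t => Real.exp (β * t)) 0 τ := by
    refine ContDiffOn.absolutelyContinuousOnInterval (ContDiff.contDiffOn ?_)
    fun_prop
  -- The function $y(t)e^{\beta t}$ is absolutely continuous with derivative at most zero almost
  -- everywhere, so it does not increase from $0$ to $\tau$.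
  have hint := (hy.fun_mul hE).integral_deriv_eq_sub
  have hneg : ∫ t in (0 : ℝ)..τ, deriv (fun t => y t * Real.exp (β * t)) t ≤ 0 := by
    rw [intervalIntegral.integral_of_le hτ, integral_Ioc_eq_integral_Ioo]
    refine integral_nonpos_of_ae ?_
    refine (ae_restrict_iff' measurableSet_Ioo).2 ?_
    filter_upwards [hd, hle] with t h1 h2 ht
    have h3 : HasDerivAt (fun t => Real.exp (β * t)) (Real.exp (β * t) * (β * 1)) t :=
      ((hasDerivAt_id t).const_mul β).exp
    rw [((h1 ht).fun_mul h3).deriv]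
    have := mul_nonpos_of_nonpos_of_nonneg
      (by linarith [h2 ht] : y' t + β * y t ≤ 0) (Real.exp_pos (β * t)).le
    simp only [Pi.zero_apply]
    linarith
  rw [hint] at hneg
  simp only [mul_zero, Real.exp_zero, mul_one] at hneg
  have hpos := Real.exp_pos (-β * τ)
  have hexp : Real.exp (β * τ) * Real.exp (-β * τ) = 1 := by
    rw [← Real.exp_add]; simp
  calc y τ = y τ * Real.exp (β * τ) * Real.exp (-β * τ) := by rw [mul_assoc, hexp, mul_one]
    _ ≤ y 0 * Real.exp (-β * τ) := mul_le_mul_of_nonneg_right (by linarith) hpos.le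

end Time

/-! ### The equations tested with functions vanishing on the boundary -/

section WeakForm

variable {D : Set R2}

theorem integrable_mul_L2 {X : Type} [MeasureSpace X] {S : Set X} (f g : L2 S) :
    Integrable (fun x => f x * g x) (volume.restrict S) :=
  (Lp.memLp f).integrable_mul (Lp.memLp g)

/-- The buoyancy direction, multiplied by a test field. -/
theorem exists_gradH_mul (hD : IsOpen D) {g : R3} {M : ℝ}
    (hM : ∀ x ∈ D, ‖gradH g (x, 0)‖ ≤ M) (i : Fin 2) (f : L2 D) :
    ∃ k : L2 D, (k =ᵐ[volume.restrict D] fun x => gradH g (x, 0) i * f x) ∧ ‖k‖ ≤ M * ‖f‖ := by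
  have hle : ∀ᵐ x ∂volume.restrict D, ‖gradH g (x, 0) i * f x‖ ≤ M * ‖f x‖ := by
    filter_upwards [ae_restrict_mem hD.measurableSet] with x hx
    rw [norm_mul]
    exact mul_le_mul_of_nonneg_right ((PiLp.norm_apply_le _ i).trans (hM x hx)) (norm_nonneg _)
  have hmeas : AEStronglyMeasurable (fun x => gradH g (x, 0) i * f x) (volume.restrict D) := by
    refine AEStronglyMeasurable.mul ?_ (Lp.aestronglyMeasurable f)
    simp only [gradH_apply]
    exact Continuous.aestronglyMeasurable (by fun_prop)
  have hm := MemLp.of_le_mul (Lp.memLp f) hmeas hle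
  refine ⟨hm.toLp _, hm.coeFn_toLp, Lp.norm_le_mul_norm_of_ae_le_mul ?_⟩
  filter_upwards [hle, hm.coeFn_toLp] with x h1 h2
  rwa [h2]

theorem sum_inner_laplacian {E : Type} [NormedAddCommGroup E] [NormedSpace ℝ E] [MeasureSpace E]
    [BorelSpace E] [FiniteDimensional ℝ E] [(volume : Measure E).IsAddHaarMeasure]
    {ι : Type} [Fintype ι] {e : ι → E} {Ω : Set E} (hΩ : IsOpen Ω) {f h : L2 Ω}
    (hf : MemW22 e Ω f) (hh : MemW120 e Ω h) :
    ∑ k, inner ℝ (weakDeriv Ω (e k) (weakDeriv Ω (e k) f)) h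
      = - ∑ k, inner ℝ (weakDeriv Ω (e k) f) (weakDeriv Ω (e k) h) := by
  rw [← Finset.sum_neg_distrib]
  refine Finset.sum_congr rfl fun k _ => ?_
  rw [((hf.2 k).hasWeakDeriv k).inner_weakDeriv hΩ hh, neg_neg]

/-- A component of the momentum equation, tested with `W`. -/
theorem momentum_component (hD : IsOpen D) {μ : ℝ} {g : R3} {U A F : L2v D} {Θ : L2 (cyl D)}
    {q : L2 D} (hU22 : ∀ i, MemW22 e2 D (U i)) (hU0 : ∀ i, MemW120 e2 D (U i)) {i : Fin 2}
    (heq : ∀ᵐ x ∂volume.restrict D,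
      A i x + ∑ j, U j x * weakDeriv D (e2 j) (U i) x + weakDeriv D (e2 i) q x
        = μ * ∑ j, weakDeriv D (e2 j) (weakDeriv D (e2 j) (U i)) x
          - vAvg Θ x * gradH g (x, 0) i + F i x)
    {W k : L2 D} (hW : MemW120 e2 D W)
    (hk : k =ᵐ[volume.restrict D] fun x => gradH g (x, 0) i * W x) :
    inner ℝ (A i) W + (∑ j, ∫ x in D, U j x * weakDeriv D (e2 j) (U i) x * W x)
        + inner ℝ (weakDeriv D (e2 i) q) W
      = -μ * ∑ j, inner ℝ (weakDeriv D (e2 j) (U i)) (weakDeriv D (e2 j) W)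
        - inner ℝ Θ (liftL2 D k) + inner ℝ (F i) W := by
  have hemb := embedsL4_R2 hD
  have ht (j : Fin 2) := integrable_trilinear (hemb.memLp (hU0 j)) (hemb.memLp hW)
    (weakDeriv D (e2 j) (U i))
  have hv := integral_vAvg_mul Θ k
  have hlap := sum_inner_laplacian hD (hU22 i) hW
  have h1 : ∫ x in D, (A i x * W x + ∑ j, U j x * weakDeriv D (e2 j) (U i) x * W x
        + weakDeriv D (e2 i) q x * W x)
      = ∫ x in D, (μ * (∑ j, weakDeriv D (e2 j) (weakDeriv D (e2 j) (U i)) x * W x)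
        - vAvg Θ x * k x + F i x * W x) := by
    refine integral_congr_ae ?_
    filter_upwards [heq, hk] with x hx hkx
    rw [hkx]
    have := congrArg (· * W x) hx
    simp only [add_mul, sub_mul, mul_assoc, Finset.sum_mul] at this
    simpa only [mul_assoc] using this
  have i1 : Integrable (fun x => A i x * W x
      + ∑ j, U j x * weakDeriv D (e2 j) (U i) x * W x) (volume.restrict D) :=
    (integrable_mul_L2 _ _).add (integrable_finsetSum _ fun j _ => ht j)
  have i2 : Integrable (fun x => μ * ∑ j, weakDeriv D (e2 j) (weakDeriv D (e2 j) (U i)) x * W x)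
      (volume.restrict D) :=
    (integrable_finsetSum _ fun j _ => integrable_mul_L2 _ _).const_mul μ
  have i3 : Integrable (fun x => μ * ∑ j, weakDeriv D (e2 j) (weakDeriv D (e2 j) (U i)) x * W x
      - vAvg Θ x * k x) (volume.restrict D) := i2.sub hv.1
  rw [integral_add i1 (integrable_mul_L2 _ _),
    integral_add (integrable_mul_L2 _ _) (integrable_finsetSum _ fun j _ => ht j),
    integral_finsetSum _ fun j _ => ht j, integral_add i3 (integrable_mul_L2 _ _),
    integral_sub i2 hv.1, integral_const_mul,
    integral_finsetSum _ fun j _ => integrable_mul_L2 _ _, hv.2] at h1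
  simp only [← inner_L2, hlap] at h1
  linarith

/-- The heat equation, tested with `Z`. -/
theorem heat_weak (hD : IsOpen D) (hb : Bornology.IsBounded D) {κ : ℝ} {U : L2v D}
    {Θ B : L2 (cyl D)} (hΘ : MemW22 e3 (cyl D) Θ) (hU0 : ∀ i, MemW120 e2 D (U i))
    (heq : ∀ᵐ x ∂volume.restrict (cyl D),
      B x + ∑ j : Fin 2, U j x.1 * weakDeriv (cyl D) (e2 j, 0) Θ x
        = κ * ∑ k, weakDeriv (cyl D) (e3 k) (weakDeriv (cyl D) (e3 k) Θ) x)
    {Z : L2 (cyl D)} (hZ : MemW120 e3 (cyl D) Z) :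
    inner ℝ B Z + ∑ j : Fin 2, ∫ x in cyl D, U j x.1 * weakDeriv (cyl D) (e2 j, 0) Θ x * Z x
      = -κ * ∑ k, inner ℝ (weakDeriv (cyl D) (e3 k) Θ) (weakDeriv (cyl D) (e3 k) Z) := by
  have hemb := embedsL4_R3 (isOpen_cyl hD) (isBounded_cyl hb)
  have ht (j : Fin 2) := integrable_trilinear (S := cyl D) (b := fun x : R3 => U j x.1)
    (memLp_comp_fst ((embedsL4_R2 hD).memLp (hU0 j)))
    (hemb.memLp hZ) (weakDeriv (cyl D) (e2 j, 0) Θ)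
  have hlap := sum_inner_laplacian (isOpen_cyl hD) hΘ hZ
  have h1 : ∫ x in cyl D, (B x * Z x
        + ∑ j : Fin 2, U j x.1 * weakDeriv (cyl D) (e2 j, 0) Θ x * Z x)
      = ∫ x in cyl D,
        κ * (∑ k, weakDeriv (cyl D) (e3 k) (weakDeriv (cyl D) (e3 k) Θ) x * Z x) := by
    refine integral_congr_ae ?_
    filter_upwards [heq] with x hx
    have := congrArg (· * Z x) hx
    simp only [add_mul, mul_assoc, Finset.sum_mul] at this
    simpa only [mul_assoc] using this
  rw [integral_add (integrable_mul_L2 _ _) (integrable_finsetSum _ fun j _ => ht j),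
    integral_finsetSum _ fun j _ => ht j,
    integral_const_mul, integral_finsetSum _ fun j _ => integrable_mul_L2 _ _] at h1
  simp only [← inner_L2, hlap] at h1
  linarith

end WeakForm

/-! ### Energy inequality for the velocity difference -/

section Difference

variable {D : Set R2}

/-- The `L²` norm of the velocity gradient. -/
noncomputable def gradNormV (D : Set R2) (v : L2v D) : ℝ := √(∑ i, gradNorm e2 D (v i) ^ 2)

theorem gradNormV_sq (v : L2v D) : gradNormV D v ^ 2 = ∑ i, gradNorm e2 D (v i) ^ 2 :=
  Real.sq_sqrt (by positivity)

theorem gradNormV_nonneg (v : L2v D) : 0 ≤ gradNormV D v := Real.sqrt_nonneg _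

theorem gradNorm_le_gradNormV (v : L2v D) (i : Fin 2) : gradNorm e2 D (v i) ≤ gradNormV D v := by
  refine Real.le_sqrt_of_sq_le ?_
  exact Finset.single_le_sum (f := fun i => gradNorm e2 D (v i) ^ 2)
    (fun i _ => by positivity) (Finset.mem_univ i)

theorem w12NormV_sq (v : L2v D) : w12NormV D v ^ 2 = ‖v‖ ^ 2 + gradNormV D v ^ 2 := by
  rw [w12NormV, Real.sq_sqrt (by positivity), gradNormV_sq, PiLp.norm_sq_eq_of_L2,
    ← Finset.sum_add_distrib]
  simp only [w12Norm_sq]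

theorem w12NormV_nonneg (v : L2v D) : 0 ≤ w12NormV D v := Real.sqrt_nonneg _

theorem gradNormV_le_w12NormV (v : L2v D) : gradNormV D v ≤ w12NormV D v :=
  abs_le_of_sq_le_sq' (by rw [w12NormV_sq]; nlinarith [sq_nonneg ‖v‖]) (w12NormV_nonneg v) |>.2

theorem norm_le_w12NormV (v : L2v D) : ‖v‖ ≤ w12NormV D v :=
  abs_le_of_sq_le_sq' (by rw [w12NormV_sq]; nlinarith [sq_nonneg (gradNormV D v)])
    (w12NormV_nonneg v) |>.2

theorem w12NormV_le (v : L2v D) : w12NormV D v ≤ ‖v‖ + gradNormV D v :=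
  abs_le_of_sq_le_sq' (by
    rw [w12NormV_sq]
    nlinarith [mul_nonneg (norm_nonneg v) (gradNormV_nonneg v)])
    (add_nonneg (norm_nonneg _) (gradNormV_nonneg v)) |>.2

theorem w12NormV_neg (hD : IsOpen D) {v : L2v D} (hv : ∀ i, MemW12 e2 D (v i)) :
    w12NormV D (-v) = w12NormV D v := by
  have h (i j : Fin 2) : weakDeriv D (e2 j) (-v i) = -weakDeriv D (e2 j) (v i) := by
    refine HasWeakDeriv.weakDeriv_eq hD ?_
    have := (hv i).hasWeakDeriv j
    rw [hasWeakDeriv_iff] at this ⊢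
    intro φ hφ
    rw [inner_neg_left, inner_neg_left, this φ hφ]
  simp [w12NormV, w12Norm, h]

/-- Hölder's inequality puts both factors `W` in $L^4$, where Ladyzhenskaya's inequality gives
$(\|W\|\|\nabla W\|)^{1/2}$ for each. The gradient of `W` thus enters to the first power only and
can be absorbed. The factor 4 counts the pairs of indices. -/
theorem abs_sum_stretching_le (hD : IsOpen D) :
    ∃ C ≥ (0 : ℝ), ∀ U W : L2v D, (∀ i, MemW120 e2 D (W i)) →
      |∑ i, ∑ j, ∫ x in D, W j x * weakDeriv D (e2 j) (U i) x * W i x|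
        ≤ C * w12NormV D U * (‖W‖ * gradNormV D W) := by
  obtain ⟨C, hC0, hC⟩ := exists_eLpNorm_four_le_R2 hD
  refine ⟨4 * C, by positivity, fun U W hW => ?_⟩
  have hWG := mul_nonneg (norm_nonneg W) (gradNormV_nonneg W)
  have h4 (i : Fin 2) : (eLpNorm (W i) 4 (volume.restrict D)).toReal
      ≤ √(C * (‖W‖ * gradNormV D W)) := by
    refine ENNReal.toReal_le_of_le_ofReal (Real.sqrt_nonneg _) ((hC _ (hW i)).trans ?_)
    refine ENNReal.ofReal_le_ofReal (Real.sqrt_le_sqrt (mul_le_mul_of_nonneg_left ?_ hC0))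
    exact mul_le_mul (PiLp.norm_apply_le W i) (gradNorm_le_gradNormV W i) (gradNorm_nonneg _)
      (norm_nonneg _)
  have hterm (i j : Fin 2) : |∫ x in D, W j x * weakDeriv D (e2 j) (U i) x * W i x|
      ≤ C * (‖W‖ * gradNormV D W) * w12NormV D U := by
    refine (abs_integral_trilinear_le ((embedsL4_R2 hD).memLp (hW j))
      ((embedsL4_R2 hD).memLp (hW i)) _).trans ?_
    refine mul_le_mul ?_ ((norm_weakDeriv_le (U i) j).trans ((gradNorm_le_gradNormV U i).trans
      (gradNormV_le_w12NormV U))) (norm_nonneg _) (mul_nonneg hC0 hWG)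
    refine (mul_le_mul (h4 j) (h4 i) ENNReal.toReal_nonneg (Real.sqrt_nonneg _)).trans ?_
    rw [Real.mul_self_sqrt (mul_nonneg hC0 hWG)]
  refine (Finset.abs_sum_le_sum_abs _ _).trans ((Finset.sum_le_sum fun i _ =>
    (Finset.abs_sum_le_sum_abs _ _).trans (Finset.sum_le_sum fun j _ => hterm i j)).trans ?_)
  simp only [Finset.sum_const, Finset.card_univ, Fintype.card_fin, nsmul_eq_mul]
  refine le_of_eq ?_
  push_cast
  ring

/-- A velocity field at a fixed time, together with its equation. -/
structure IsVelocity (D : Set R2) (μ : ℝ) (g : R3) (U A F : L2v D) (Θ : L2 (cyl D)) : Prop where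
  mem_W22 : ∀ i, MemW22 e2 D (U i)
  mem_W120 : ∀ i, MemW120 e2 D (U i)
  div_free : ∑ i, weakDeriv D (e2 i) (U i) = 0
  momentum : ∃ p : L2 D, MemW12 e2 D p ∧ ∀ i, ∀ᵐ x ∂volume.restrict D,
    A i x + ∑ j, U j x * weakDeriv D (e2 j) (U i) x + weakDeriv D (e2 i) p x
      = μ * ∑ j, weakDeriv D (e2 j) (weakDeriv D (e2 j) (U i)) x
        - vAvg Θ x * gradH g (x, 0) i + F i x

/-- The pressure drops out because its gradient is orthogonal to divergence free fields in
$W^{1,2}_0$. -/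
theorem IsVelocity.weak (hD : IsOpen D) {μ : ℝ} {g : R3} {U A F : L2v D} {Θ : L2 (cyl D)}
    (hU : IsVelocity D μ g U A F Θ) {W k : L2v D} (hW : ∀ i, MemW120 e2 D (W i))
    (hdiv : ∑ i, weakDeriv D (e2 i) (W i) = 0)
    (hk : ∀ i, k i =ᵐ[volume.restrict D] fun x => gradH g (x, 0) i * W i x) :
    inner ℝ A W + ∑ i, (∑ j, ∫ x in D, U j x * weakDeriv D (e2 j) (U i) x * W i x)
      = -μ * ∑ i, ∑ j, inner ℝ (weakDeriv D (e2 j) (U i)) (weakDeriv D (e2 j) (W i))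
        - inner ℝ Θ (∑ i, liftL2 D (k i)) + inner ℝ F W := by
  obtain ⟨p, hp, heq⟩ := hU.momentum
  have h := Finset.sum_congr (rfl : (Finset.univ : Finset (Fin 2)) = Finset.univ) fun i _ =>
    momentum_component hD hU.mem_W22 hU.mem_W120 (heq i) (hW i) (hk i)
  have hpr : ∑ i, inner ℝ (weakDeriv D (e2 i) p) (W i) = (0 : ℝ) := by
    have (i : Fin 2) : inner ℝ (weakDeriv D (e2 i) p) (W i)
        = -inner ℝ p (weakDeriv D (e2 i) (W i)) := by
      rw [(hp.hasWeakDeriv i).inner_weakDeriv hD (hW i), neg_neg]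
    simp only [this]
    rw [Finset.sum_neg_distrib, ← inner_sum, hdiv, inner_zero_right, neg_zero]
  simp only [Finset.sum_add_distrib, Finset.sum_sub_distrib, ← Finset.mul_sum, hpr] at h
  rw [PiLp.inner_apply, PiLp.inner_apply, inner_sum]
  linarith

/-- The splitting $bf-cg=(b-c)f+c(f-g)$ pairs the difference of velocities with the gradient `f` of
the first solution, which will be the one in the attractor. The second term is pure transport. -/
theorem integral_transport_sub {X : Type} [MeasureSpace X] {S : Set X} {b c w h : X → ℝ}
    (hb : MemLp b 4 (volume.restrict S)) (hc : MemLp c 4 (volume.restrict S))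
    (hw : w =ᵐ[volume.restrict S] fun x => b x - c x)
    (hh : MemLp h 4 (volume.restrict S)) (f g : L2 S) :
    (∫ x in S, b x * f x * h x) - ∫ x in S, c x * g x * h x
      = (∫ x in S, w x * f x * h x) + ∫ x in S, c x * (f - g : L2 S) x * h x := by
  have hwm : MemLp w 4 (volume.restrict S) := (hb.sub hc).ae_eq hw.symm
  rw [← integral_sub (integrable_trilinear hb hh f) (integrable_trilinear hc hh g),
    ← integral_add (integrable_trilinear hwm hh f) (integrable_trilinear hc hh (f - g))]
  refine integral_congr_ae ?_
  filter_upwards [hw, Lp.coeFn_sub f g] with x h1 h2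
  rw [h1, h2, Pi.sub_apply]
  ring

/-- The energy inequality for the difference of two velocities. -/
theorem velocity_difference (hD : IsOpen D) :
    ∃ C ≥ (0 : ℝ), ∀ (μ M : ℝ) (g : R3) (U A F U' A' F' : L2v D) (Θ Θ' : L2 (cyl D)),
      (∀ x ∈ D, ‖gradH g (x, 0)‖ ≤ M) →
      IsVelocity D μ g U A F Θ → IsVelocity D μ g U' A' F' Θ' →
      inner ℝ (A - A') (U - U') ≤ -μ * gradNormV D (U - U') ^ 2
        + C * w12NormV D U * (‖U - U'‖ * gradNormV D (U - U'))
        + 2 * M * ‖Θ - Θ'‖ * ‖U - U'‖ + inner ℝ (F - F') (U - U') := by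
  obtain ⟨C, hC0, hC⟩ := abs_sum_stretching_le hD
  refine ⟨C, hC0, fun μ M g U A F U' A' F' Θ Θ' hM hU hU' => ?_⟩
  set W := U - U' with hWdef
  have hWi (i : Fin 2) : W i = U i - U' i := rfl
  have hW (i : Fin 2) : MemW120 e2 D (W i) := (hU.mem_W120 i).sub hD (hU'.mem_W120 i)
  have hdW (i j : Fin 2) :
      weakDeriv D (e2 j) (W i) = weakDeriv D (e2 j) (U i) - weakDeriv D (e2 j) (U' i) :=
    (hU.mem_W120 i).1.weakDeriv_sub hD (hU'.mem_W120 i).1 j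
  have hdiv : ∑ i, weakDeriv D (e2 i) (W i) = 0 := by
    simp only [hdW, Finset.sum_sub_distrib, hU.div_free, hU'.div_free, sub_zero]
  choose k hk hkn using fun i => exists_gradH_mul hD hM i (W i)
  have e1 := hU.weak hD (k := WithLp.toLp 2 k) hW hdiv hk
  have e2 := hU'.weak hD (k := WithLp.toLp 2 k) hW hdiv hk
  have hemb := embedsL4_R2 hD
  -- The transport of `W` by `U'` conserves energy, so only the stretching by the gradient of `U`
  -- survives.
  have htr : (∑ i, ∑ j, ∫ x in D, U j x * weakDeriv D (ROB.e2 j) (U i) x * W i x)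
      - (∑ i, ∑ j, ∫ x in D, U' j x * weakDeriv D (ROB.e2 j) (U' i) x * W i x)
      = ∑ i, ∑ j, ∫ x in D, W j x * weakDeriv D (ROB.e2 j) (U i) x * W i x := by
    have hz (i : Fin 2) := sum_integral_transport_R2 hD hU'.mem_W120 hU'.div_free (hW i)
    simp only [hdW] at hz
    rw [← Finset.sum_sub_distrib]
    refine Finset.sum_congr rfl fun i _ => ?_
    rw [← Finset.sum_sub_distrib]
    simp only [fun j => integral_transport_sub (hemb.memLp (hU.mem_W120 j))
      (hemb.memLp (hU'.mem_W120 j)) (w := W j) (Lp.coeFn_sub (U j) (U' j)) (hemb.memLp (hW i))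
      (weakDeriv D (ROB.e2 j) (U i)) (weakDeriv D (ROB.e2 j) (U' i))]
    rw [Finset.sum_add_distrib, hz i, add_zero]
  have hG : (∑ i, ∑ j, inner ℝ (weakDeriv D (ROB.e2 j) (U i)) (weakDeriv D (ROB.e2 j) (W i)))
      - (∑ i, ∑ j, inner ℝ (weakDeriv D (ROB.e2 j) (U' i)) (weakDeriv D (ROB.e2 j) (W i)))
      = gradNormV D W ^ 2 := by
    rw [← Finset.sum_sub_distrib, gradNormV_sq]
    refine Finset.sum_congr rfl fun i _ => ?_
    rw [← Finset.sum_sub_distrib, gradNorm_sq]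
    refine Finset.sum_congr rfl fun j _ => ?_
    rw [← inner_sub_left, ← hdW, real_inner_self_eq_norm_sq]
  have hbuoy : -inner ℝ (Θ - Θ') (∑ i, liftL2 D (k i)) ≤ 2 * M * ‖Θ - Θ'‖ * ‖W‖ := by
    refine (neg_le_abs _).trans ((abs_real_inner_le_norm _ _).trans ?_)
    have : ‖∑ i, liftL2 D (k i)‖ ≤ 2 * (M * ‖W‖) := by
      refine (norm_sum_le _ _).trans ?_
      simp only [LinearIsometry.norm_map, Fin.sum_univ_two, two_mul]
      -- The bound `hM` forces $M\ge0$ unless `D` is empty, and then all norms vanish.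
      have hM0 : 0 ≤ M ∨ D = ∅ := by
        rcases D.eq_empty_or_nonempty with h | ⟨x, hx⟩
        · exact .inr h
        · exact .inl ((norm_nonneg _).trans (hM x hx))
      rcases hM0 with hM0 | rfl
      · exact add_le_add ((hkn 0).trans (mul_le_mul_of_nonneg_left (PiLp.norm_apply_le W 0) hM0))
          ((hkn 1).trans (mul_le_mul_of_nonneg_left (PiLp.norm_apply_le W 1) hM0))
      · have hz (f : L2 (∅ : Set R2)) : ‖f‖ = 0 := by simp [Lp.norm_def]
        simp [hz, PiLp.norm_eq_of_L2]
    calc ‖Θ - Θ'‖ * ‖∑ i, liftL2 D (k i)‖ ≤ ‖Θ - Θ'‖ * (2 * (M * ‖W‖)) := by gcongr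
      _ = 2 * M * ‖Θ - Θ'‖ * ‖W‖ := by ring
  have hst := neg_le_of_abs_le (hC U W hW)
  rw [inner_sub_left, inner_sub_left]
  rw [inner_sub_left] at hbuoy
  simp only at e1 e2
  have hμ := congrArg (μ * ·) hG
  simp only [mul_sub] at hμ
  linarith

end Difference

/-! ### Nonlocal boundary condition and the temperature difference -/

section Temperature

variable {D : Set R2}

theorem isFiniteMeasure_restrict_cyl (hb : Bornology.IsBounded D) :
    IsFiniteMeasure ((volume : Measure R3).restrict (cyl D)) :=
  ⟨by rw [Measure.restrict_apply_univ]; exact (isBounded_cyl hb).measure_lt_top⟩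

theorem volume_real_cyl_pos (hD : IsOpen D) (hne : D.Nonempty) (hb : Bornology.IsBounded D) :
    0 < (volume : Measure R3).real (cyl D) := by
  refine ENNReal.toReal_pos (((isOpen_cyl hD).measure_pos _ ?_).ne')
    (isBounded_cyl hb).measure_lt_top.ne
  exact hne.prod (nonempty_Ioo.2 zero_lt_one)

/-- The constant function `1` on the cylinder. -/
noncomputable def oneCyl (D : Set R2) [IsFiniteMeasure ((volume : Measure R3).restrict (cyl D))] :
    L2 (cyl D) := (memLp_const 1).toLp (fun _ => 1)

variable [IsFiniteMeasure ((volume : Measure R3).restrict (cyl D))]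

theorem coeFn_oneCyl : oneCyl D =ᵐ[volume.restrict (cyl D)] fun _ => (1 : ℝ) :=
  MemLp.coeFn_toLp _

theorem inner_oneCyl (f : L2 (cyl D)) : inner ℝ (oneCyl D) f = ∫ x in cyl D, f x := by
  rw [inner_L2]
  refine integral_congr_ae ?_
  filter_upwards [coeFn_oneCyl (D := D)] with x hx using by rw [hx, one_mul]

theorem inner_oneCyl_self :
    inner ℝ (oneCyl D) (oneCyl D) = (volume : Measure R3).real (cyl D) := by
  rw [inner_oneCyl, integral_congr_ae coeFn_oneCyl]
  simp

theorem hasWeakDeriv_oneCyl (v : R3) : HasWeakDeriv (cyl D) v (oneCyl D) 0 := by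
  rw [hasWeakDeriv_iff]
  intro φ hφ
  rw [inner_zero_left, neg_zero, inner_oneCyl, integral_congr_ae (hφ.fderiv v).coeFn_toL2,
    setIntegral_eq_integral_of_forall_compl_eq_zero (fun x hx => (hφ.fderiv v).eq_zero hx)]
  have h := integral_mul_fderiv_eq_neg_fderiv_mul_of_integrable (μ := (volume : Measure R3))
    (f := fun _ => (1 : ℝ)) (g := φ) (v := v) (by simp)
    (by simpa using memLp_one_iff_integrable.1 ((hφ.fderiv v).memLp_volume 1))
    (by simpa using memLp_one_iff_integrable.1 (hφ.memLp_volume 1))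
    (fun x _ => differentiableAt_const _) (fun x _ => hφ.differentiable x)
  simpa using h

/-- The difference of two temperatures, corrected by its mean so as to vanish on the boundary. -/
noncomputable def meanCorrection (D : Set R2)
    [IsFiniteMeasure ((volume : Measure R3).restrict (cyl D))] (α : ℝ) (η : L2 (cyl D)) :
    L2 (cyl D) :=
  η + (α / (volume : Measure R3).real (cyl D) * inner ℝ (oneCyl D) η) • oneCyl D

theorem weakDeriv_meanCorrection (hD : IsOpen D) (α : ℝ) {η : L2 (cyl D)}
    (hη : MemW12 e3 (cyl D) η) (k : Fin 3) :
    weakDeriv (cyl D) (e3 k) (meanCorrection D α η) = weakDeriv (cyl D) (e3 k) η := by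
  refine HasWeakDeriv.weakDeriv_eq (isOpen_cyl hD) ?_
  have h1 := hη.hasWeakDeriv k
  have h2 := hasWeakDeriv_oneCyl (D := D) (e3 k)
  rw [hasWeakDeriv_iff] at h1 h2 ⊢
  intro φ hφ
  rw [meanCorrection, inner_add_left, inner_smul_left, h1 φ hφ, h2 φ hφ]
  simp

/-- For $B=\partial_t\eta$ the extra term is half the derivative of
$\alpha|\Omega|^{-1}(\int\eta)^2$; this is why the energy contains the squared mean. -/
theorem inner_meanCorrection (α : ℝ) (B η : L2 (cyl D)) :
    inner ℝ B (meanCorrection D α η) = inner ℝ B η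
      + α / (volume : Measure R3).real (cyl D) * (inner ℝ (oneCyl D) η * inner ℝ (oneCyl D) B) := by
  rw [meanCorrection, inner_add_right, inner_smul_right, real_inner_comm B (oneCyl D)]
  ring

/-- The energy of the temperature difference is controlled by its mean correction. -/
theorem energy_le_norm_meanCorrection_sq {α : ℝ} (hα : 0 < α)
    (hv : 0 < (volume : Measure R3).real (cyl D)) (η : L2 (cyl D)) :
    ‖η‖ ^ 2 + α / (volume : Measure R3).real (cyl D)
      * (inner ℝ (oneCyl D) η * inner ℝ (oneCyl D) η) ≤ ‖meanCorrection D α η‖ ^ 2 := by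
  rw [← real_inner_self_eq_norm_sq (meanCorrection D α η), inner_meanCorrection,
    real_inner_comm _ (meanCorrection D α η), inner_meanCorrection, inner_meanCorrection,
    inner_oneCyl_self, real_inner_self_eq_norm_sq]
  set s : ℝ := inner ℝ (oneCyl D) η
  set v : ℝ := (volume : Measure R3).real (cyl D)
  have h1 : α / v * (s * v) = α * s := by field_simp
  have h2 : 0 ≤ α / v * (s * s) := by have := mul_self_nonneg s; positivity
  rw [h1]
  -- With $v=|\Omega|$ and $s=\int\eta$ the right side is $\|\eta\|^2+(2\alpha+\alpha^2)s^2/v$,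
  -- which exceeds the left side by $(\alpha+\alpha^2)s^2/v$.
  nlinarith [mul_nonneg hα.le h2]

/-- The boundary condition for the difference of two temperatures. -/
theorem memW120_meanCorrection (hD : IsOpen D) {α : ℝ} {θ : R3 → ℝ} {Θ Θ' z z' : L2 (cyl D)}
    (hz : ∀ᵐ x ∂volume.restrict (cyl D), z x = Θ x - (θ x - α * ⨍ y in cyl D, Θ y))
    (hz' : ∀ᵐ x ∂volume.restrict (cyl D), z' x = Θ' x - (θ x - α * ⨍ y in cyl D, Θ' y))
    (h : MemW120 e3 (cyl D) z) (h' : MemW120 e3 (cyl D) z') :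
    MemW120 e3 (cyl D) (meanCorrection D α (Θ - Θ')) := by
  -- The boundary data cancel in `z - z'`, and only the difference of the means remains.
  convert h.sub (isOpen_cyl hD) h'
  refine Lp.ext ?_
  rw [meanCorrection]
  filter_upwards [hz, hz', Lp.coeFn_sub z z', Lp.coeFn_sub Θ Θ', coeFn_oneCyl (D := D),
    Lp.coeFn_add (Θ - Θ') ((α / (volume : Measure R3).real (cyl D)
      * inner ℝ (oneCyl D) (Θ - Θ')) • oneCyl D),
    Lp.coeFn_smul (α / (volume : Measure R3).real (cyl D)
      * inner ℝ (oneCyl D) (Θ - Θ')) (oneCyl D)] with x h1 h2 h3 h4 h5 h6 h7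
  rw [h6, h3, Pi.add_apply, Pi.sub_apply, h7, Pi.smul_apply, h5, h4, Pi.sub_apply, h1, h2,
    inner_sub_right, inner_oneCyl, inner_oneCyl, setAverage_eq, setAverage_eq]
  simp only [smul_eq_mul]
  ring

/-- A temperature at a fixed time, together with its equation. -/
structure IsTemperature (D : Set R2) (κ : ℝ) (U : L2v D) (Θ B : L2 (cyl D)) : Prop where
  mem_W22 : MemW22 e3 (cyl D) Θ
  heat : ∀ᵐ x ∂volume.restrict (cyl D),
    B x + ∑ j : Fin 2, U j x.1 * weakDeriv (cyl D) (e2 j, 0) Θ x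
      = κ * ∑ k, weakDeriv (cyl D) (e3 k) (weakDeriv (cyl D) (e3 k) Θ) x

/-- The energy inequality for the difference of two temperatures. -/
theorem temperature_difference (hD : IsOpen D) (hb : Bornology.IsBounded D) {κ α : ℝ}
    {U U' : L2v D} {Θ B Θ' B' : L2 (cyl D)}
    (hU : ∀ i, MemW120 e2 D (U i)) (hU' : ∀ i, MemW120 e2 D (U' i))
    (hdU : ∑ i, weakDeriv D (e2 i) (U i) = 0) (hdU' : ∑ i, weakDeriv D (e2 i) (U' i) = 0)
    (hΘ : IsTemperature D κ U Θ B) (hΘ' : IsTemperature D κ U' Θ' B')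
    (hΘb : MemLp Θ ⊤ (volume.restrict (cyl D)))
    (hz : MemW120 e3 (cyl D) (meanCorrection D α (Θ - Θ'))) :
    inner ℝ (B - B') (meanCorrection D α (Θ - Θ'))
      ≤ -κ * gradNorm e3 (cyl D) (meanCorrection D α (Θ - Θ')) ^ 2
        + 2 * (linfNorm (cyl D) Θ * ‖U - U'‖
          * gradNorm e3 (cyl D) (meanCorrection D α (Θ - Θ'))) := by
  set z := meanCorrection D α (Θ - Θ') with hzdef
  have hdz (k : Fin 3) : weakDeriv (cyl D) (e3 k) z
      = weakDeriv (cyl D) (e3 k) Θ - weakDeriv (cyl D) (e3 k) Θ' := by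
    rw [hzdef, weakDeriv_meanCorrection hD _ (hΘ.mem_W22.1.sub hΘ'.mem_W22.1),
      hΘ.mem_W22.1.weakDeriv_sub (isOpen_cyl hD) hΘ'.mem_W22.1]
  have hdz2 (j : Fin 2) : weakDeriv (cyl D) (e2 j, 0) z
      = weakDeriv (cyl D) (e2 j, 0) Θ - weakDeriv (cyl D) (e2 j, 0) Θ' := by
    simpa only [e3_castSucc] using hdz j.castSucc
  have e1 := heat_weak hD hb hΘ.mem_W22 hU hΘ.heat hz
  have e2 := heat_weak hD hb hΘ'.mem_W22 hU' hΘ'.heat hz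
  have hemb := embedsL4_R2 hD
  have hz4 := (embedsL4_R3 (isOpen_cyl hD) (isBounded_cyl hb)).memLp hz
  have hW (i : Fin 2) : MemW120 ROB.e2 D ((U - U') i) := (hU i).sub hD (hU' i)
  have hdiv : ∑ i, weakDeriv D (ROB.e2 i) ((U - U') i) = 0 := by
    have h (i : Fin 2) : weakDeriv D (ROB.e2 i) ((U - U') i)
        = weakDeriv D (ROB.e2 i) (U i) - weakDeriv D (ROB.e2 i) (U' i) :=
      (hU i).1.weakDeriv_sub hD (hU' i).1 i
    simp only [h, Finset.sum_sub_distrib, hdU, hdU', sub_zero]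
  -- The shift by a constant does not change gradients, so $\nabla\Theta-\nabla\Theta'=\nabla z$ and
  -- the transport of `z` by `U'` vanishes.
  have htr : (∑ j : Fin 2, ∫ x in cyl D, U j x.1 * weakDeriv (cyl D) (ROB.e2 j, 0) Θ x * z x)
      - (∑ j : Fin 2, ∫ x in cyl D, U' j x.1 * weakDeriv (cyl D) (ROB.e2 j, 0) Θ' x * z x)
      = ∑ j : Fin 2, ∫ x in cyl D,
        (U - U') j x.1 * weakDeriv (cyl D) (ROB.e2 j, 0) Θ x * z x := by
    have h0 := sum_integral_transport_cyl hD hb hU' hdU' hz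
    simp only [hdz2] at h0
    rw [← Finset.sum_sub_distrib]
    simp only [fun j : Fin 2 => integral_transport_sub (S := cyl D) (b := fun x : R3 => U j x.1)
      (c := fun x : R3 => U' j x.1) (w := fun x : R3 => (U - U') j x.1)
      (memLp_comp_fst (hemb.memLp (hU j))) (memLp_comp_fst (hemb.memLp (hU' j)))
      ((measurePreserving_fst_cyl (D := D)).quasiMeasurePreserving.ae_eq_comp
        (Lp.coeFn_sub (U j) (U' j))) hz4
      (weakDeriv (cyl D) (ROB.e2 j, 0) Θ) (weakDeriv (cyl D) (ROB.e2 j, 0) Θ')]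
    rw [Finset.sum_add_distrib, h0, add_zero]
  have hH : (∑ k, inner ℝ (weakDeriv (cyl D) (e3 k) Θ) (weakDeriv (cyl D) (e3 k) z))
      - (∑ k, inner ℝ (weakDeriv (cyl D) (e3 k) Θ') (weakDeriv (cyl D) (e3 k) z))
      = gradNorm e3 (cyl D) z ^ 2 := by
    rw [← Finset.sum_sub_distrib, gradNorm_sq]
    refine Finset.sum_congr rfl fun k _ => ?_
    rw [← inner_sub_left, ← hdz, real_inner_self_eq_norm_sq]
  have hst := neg_le_of_abs_le (abs_sum_integral_transport_le hD hb hW hdiv hΘ.mem_W22.1 hΘb hz)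
  have hκ := congrArg (κ * ·) hH
  simp only [mul_sub] at hκ
  rw [inner_sub_left]
  linarith

/-- Poincaré's inequality in the cylinder. -/
theorem exists_norm_le_gradNorm (hD : IsOpen D) (hb : Bornology.IsBounded D) :
    ∃ C ≥ (0 : ℝ), ∀ z : L2 (cyl D), MemW120 e3 (cyl D) z →
      ‖z‖ ≤ C * gradNorm e3 (cyl D) z := by
  obtain ⟨C, hC0, hC⟩ := exists_eLpNorm_le_R3 (isOpen_cyl hD) (isBounded_cyl hb) (q := 2)
    (by norm_num)
  refine ⟨C, hC0, fun z hz => ?_⟩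
  have h := hC z hz
  rw [ENNReal.coe_ofNat, eLpNorm_L2] at h
  exact (ENNReal.ofReal_le_ofReal_iff (mul_nonneg hC0 (gradNorm_nonneg _))).1 h

end Temperature

/-! ### Nudging, absorption and the energy of the error -/

section Assimilation

variable {D : Set R2}

theorem IsStrongSolution.ae_isVelocity {P : Params} {J : Set ℝ} {f u : ℝ → L2v D}
    {Θ : ℝ → L2 (cyl D)} (h : IsStrongSolution D P J f u Θ) :
    ∀ᵐ t ∂volume.restrict J, IsVelocity D P.μ P.g (u t) (deriv u t) (f t) (Θ t) := by
  filter_upwards [h.space_u.1, h.bc_u, h.div_free, h.momentum] with t h1 h2 h3 h4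
  exact ⟨h1, h2, h3, h4⟩

theorem IsStrongSolution.ae_isTemperature {P : Params} {J : Set ℝ} {f u : ℝ → L2v D}
    {Θ : ℝ → L2 (cyl D)} (h : IsStrongSolution D P J f u Θ) :
    ∀ᵐ t ∂volume.restrict J, IsTemperature D P.κ (u t) (Θ t) (deriv Θ t) := by
  filter_upwards [h.space_Θ.1, h.heat] with t h1 h2
  exact ⟨h1, h2⟩

/-- The nudging term is dissipative up to the interpolation error. -/
theorem inner_nudging_le {Λ r G : ℝ} {w p : L2v D} (hΛ : 0 ≤ Λ) (hr : Λ * r ≤ 1)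
    (hG : ‖p + w‖ ≤ r * (‖w‖ + G)) (hG0 : 0 ≤ G) :
    inner ℝ (Λ • p) w ≤ (‖w‖ + G) * ‖w‖ - Λ * ‖w‖ ^ 2 := by
  have h1 : inner ℝ (Λ • p) w = Λ * inner ℝ (p + w) w - Λ * ‖w‖ ^ 2 := by
    rw [inner_add_left, real_inner_self_eq_norm_sq, real_inner_smul_left]
    ring
  have h2 : Λ * inner ℝ (p + w) w ≤ (‖w‖ + G) * ‖w‖ := by
    calc Λ * inner ℝ (p + w) w ≤ Λ * ((r * (‖w‖ + G)) * ‖w‖) :=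
          mul_le_mul_of_nonneg_left ((real_inner_le_norm _ _).trans
            (mul_le_mul_of_nonneg_right hG (norm_nonneg _))) hΛ
      _ = (Λ * r) * ((‖w‖ + G) * ‖w‖) := by ring
      _ ≤ 1 * ((‖w‖ + G) * ‖w‖) :=
          mul_le_mul_of_nonneg_right hr (by positivity)
      _ = (‖w‖ + G) * ‖w‖ := one_mul _
  linarith

/-- The interpolant acts on $\tilde u_h-u_h=-w$ and need not be linear, so the sign stays inside.
The rate `ρ` may be negative, hence the absolute value. -/
theorem IsInterpolant.norm_add_le {Ibar ρ : ℝ → ℝ} {I : ℝ → L2v D → L2v D} (hD : IsOpen D)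
    (hI : IsInterpolant D Ibar ρ I) {δ : ℝ} (hδ : 0 < δ) {w : L2v D}
    (hw : ∀ i, MemW12 e2 D (w i)) :
    ‖I δ (-w) + w‖ ≤ |ρ δ| * (‖w‖ + gradNormV D w) := by
  have hneg : ∀ i, MemW12 e2 D ((-w) i) := fun i j => ⟨-weakDeriv D (e2 j) (w i), by
    have := (hw i).hasWeakDeriv j
    rw [hasWeakDeriv_iff] at this ⊢
    intro φ hφ
    rw [PiLp.neg_apply, inner_neg_left, inner_neg_left, this φ hφ]⟩
  have h := hI.approx δ hδ (-w) hneg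
  rw [sub_neg_eq_add, w12NormV_neg hD hw] at h
  exact h.trans (mul_le_mul (le_abs_self _) (w12NormV_le w) (w12NormV_nonneg w) (abs_nonneg _))

/-- Absorption of the lower order terms into the dissipation. -/
theorem dissipation_le {μ κ Λ A B a G H y p : ℝ} (hμ : 0 < μ) (hκ : 0 < κ)
    (hΛ : 2 + A ^ 2 / (4 * μ) + B ^ 2 / (2 * κ) ≤ Λ) (hp : 0 < p) (hy : y ≤ p * H ^ 2) :
    -μ * G ^ 2 - κ * H ^ 2 + A * (a * G) + B * (a * H) + (1 - Λ) * a ^ 2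
      ≤ -min 1 (κ / (2 * p)) * (a ^ 2 + y) := by
  -- Young's inequality by completing squares: the velocity term may use all of $\mu G^2$, the
  -- temperature term only half of $\kappa H^2$, since the other half must control `y`.
  have h1 : A * (a * G) ≤ μ * G ^ 2 + A ^ 2 / (4 * μ) * a ^ 2 := by
    have : μ * G ^ 2 + A ^ 2 / (4 * μ) * a ^ 2 - A * (a * G)
        = μ * (G - A * a / (2 * μ)) ^ 2 := by
      field_simp
      ring
    nlinarith [mul_nonneg hμ.le (sq_nonneg (G - A * a / (2 * μ)))]
  have h2 : B * (a * H) ≤ κ / 2 * H ^ 2 + B ^ 2 / (2 * κ) * a ^ 2 := by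
    have : κ / 2 * H ^ 2 + B ^ 2 / (2 * κ) * a ^ 2 - B * (a * H)
        = κ / 2 * (H - B * a / κ) ^ 2 := by
      field_simp
      ring
    nlinarith [mul_nonneg (half_pos hκ).le (sq_nonneg (H - B * a / κ))]
  -- Of the 2 in `hΛ`, one unit cancels the $1$ in $1-\Lambda$ and the other leaves $-a^2$.
  have h3 := mul_le_mul_of_nonneg_right hΛ (sq_nonneg a)
  have hm0 : 0 ≤ min 1 (κ / (2 * p)) := le_min zero_le_one (by positivity)
  have h4 : min 1 (κ / (2 * p)) * y ≤ κ / 2 * H ^ 2 := by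
    calc min 1 (κ / (2 * p)) * y ≤ min 1 (κ / (2 * p)) * (p * H ^ 2) :=
          mul_le_mul_of_nonneg_left hy hm0
      _ ≤ κ / (2 * p) * (p * H ^ 2) :=
          mul_le_mul_of_nonneg_right (min_le_right _ _) (by positivity)
      _ = κ / 2 * H ^ 2 := by field_simp
  have h5 : min 1 (κ / (2 * p)) * a ^ 2 ≤ 1 * a ^ 2 :=
    mul_le_mul_of_nonneg_right (min_le_left _ _) (sq_nonneg a)
  nlinarith

theorem IsInAttractor.bounds {P : Params} {ℰ : ℝ} {u : ℝ → L2v D} {Θ : ℝ → L2 (cyl D)}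
    (h : IsInAttractor D P ℰ u Θ) (t : ℝ) :
    w12NormV D (u t) ≤ ℰ ∧ ‖Θ t‖ ≤ ℰ ∧ linfNorm (cyl D) (Θ t) ≤ ℰ := by
  have h1 := h.bound_sup t
  have h2 := w12NormV_nonneg (u t)
  have h3 := norm_le_w12Norm (e := e3) (Θ t)
  have h4 : 0 ≤ linfNorm (cyl D) (Θ t) := ENNReal.toReal_nonneg
  have h5 := norm_nonneg (Θ t)
  exact ⟨by linarith, by linarith, by linarith⟩

variable [IsFiniteMeasure ((volume : Measure R3).restrict (cyl D))]

/-- The energy of the difference of two solutions. -/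
noncomputable def energy (D : Set R2)
    [IsFiniteMeasure ((volume : Measure R3).restrict (cyl D))] (α : ℝ)
    (w : L2v D) (η : L2 (cyl D)) : ℝ :=
  inner ℝ w w + (inner ℝ η η + α / (volume : Measure R3).real (cyl D)
    * (inner ℝ (oneCyl D) η * inner ℝ (oneCyl D) η))

theorem sq_add_sq_le_energy {α : ℝ} (hα : 0 < α) (w : L2v D) (η : L2 (cyl D)) :
    ‖w‖ ^ 2 + ‖η‖ ^ 2 ≤ energy D α w η := by
  rw [energy, real_inner_self_eq_norm_sq, real_inner_self_eq_norm_sq]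
  have : 0 ≤ α / (volume : Measure R3).real (cyl D)
      * (inner ℝ (oneCyl D) η * inner ℝ (oneCyl D) η) :=
    mul_nonneg (div_nonneg hα.le measureReal_nonneg) (mul_self_nonneg _)
  linarith

/-- By Cauchy–Schwarz $(\int\eta)^2\le|\Omega|\|\eta\|^2$, so for $\alpha<1$ the energy is at most
$\|w\|^2+2\|\eta\|^2$. -/
theorem energy_le {α : ℝ} (hα : 0 < α) (hα1 : α < 1)
    (hv : 0 < (volume : Measure R3).real (cyl D)) (w : L2v D) (η : L2 (cyl D)) :
    energy D α w η ≤ (2 * (‖w‖ + ‖η‖)) ^ 2 := by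
  have h1 := real_inner_mul_inner_self_le (oneCyl D) η
  rw [inner_oneCyl_self, real_inner_self_eq_norm_sq] at h1
  have h2 : α / (volume : Measure R3).real (cyl D)
      * (inner ℝ (oneCyl D) η * inner ℝ (oneCyl D) η) ≤ ‖η‖ ^ 2 := by
    calc _ ≤ α / (volume : Measure R3).real (cyl D)
          * ((volume : Measure R3).real (cyl D) * ‖η‖ ^ 2) :=
          mul_le_mul_of_nonneg_left h1 (by positivity)
      _ = α * ‖η‖ ^ 2 := by field_simp
      _ ≤ 1 * ‖η‖ ^ 2 := mul_le_mul_of_nonneg_right hα1.le (sq_nonneg _)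
      _ = ‖η‖ ^ 2 := one_mul _
  rw [energy, real_inner_self_eq_norm_sq, real_inner_self_eq_norm_sq]
  nlinarith [mul_nonneg (norm_nonneg w) (norm_nonneg η), sq_nonneg ‖w‖, sq_nonneg ‖η‖]

theorem hasDerivAt_energy (α : ℝ) {w : ℝ → L2v D} {η : ℝ → L2 (cyl D)} {w' : L2v D}
    {η' : L2 (cyl D)} {t : ℝ} (hw : HasDerivAt w w' t) (hη : HasDerivAt η η' t) :
    HasDerivAt (fun t => energy D α (w t) (η t))
      (2 * (inner ℝ w' (w t) + inner ℝ η' (meanCorrection D α (η t)))) t := by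
  have h1 := hw.inner ℝ hw
  have h2 := hη.inner ℝ hη
  have h3 := (hasDerivAt_const t (oneCyl D)).inner ℝ hη
  convert! h1.add (h2.add ((h3.mul h3).const_mul (α / (volume : Measure R3).real (cyl D))))
    using 1
  rw [inner_meanCorrection, inner_zero_left, add_zero, real_inner_comm (w t) w',
    real_inner_comm (η t) η']
  ring

theorem absolutelyContinuousOnInterval_energy (α : ℝ) {w : ℝ → L2v D} {η : ℝ → L2 (cyl D)}
    {a b : ℝ} (hw : AbsolutelyContinuousOnInterval w a b)
    (hη : AbsolutelyContinuousOnInterval η a b) :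
    AbsolutelyContinuousOnInterval (fun t => energy D α (w t) (η t)) a b :=
  hw.inner_self.add (hη.inner_self.add
    (((hη.inner_const (oneCyl D)).fun_mul (hη.inner_const (oneCyl D))).const_mul _))

end Assimilation

/-- The energy of the synchronization error decays exponentially. -/
theorem exists_energy_decay {D : Set R2} (hD : IsC2Domain D)
    [IsFiniteMeasure ((volume : Measure R3).restrict (cyl D))]
    {μ κ : ℝ} (hμ : 0 < μ) (hκ : 0 < κ) {α : ℝ} (hα0 : 0 < α) (M ℰ : ℝ) :
    ∃ Λ₀ > 0, ∃ β > 0, ∀ Λ ≥ Λ₀, ∀ (ρ Ibar : ℝ → ℝ) (I : ℝ → L2v D → L2v D),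
      IsInterpolant D Ibar ρ I → ∀ δ > 0, Λ * |ρ δ| ≤ 1 →
      ∀ (g : R3) (θB : R3 → ℝ), (∀ x ∈ D, ‖gradH g (x, 0)‖ ≤ M) →
      ∀ (u : ℝ → L2v D) (Θ : ℝ → L2 (cyl D)), IsInAttractor D ⟨μ, κ, α, g, θB⟩ ℰ u Θ →
      ∀ (J : Set ℝ), J.OrdConnected → 0 ∈ J → ∀ (u' : ℝ → L2v D) (Θ' : ℝ → L2 (cyl D)),
        IsNudgedSolution D ⟨μ, κ, α, g, θB⟩ J Λ (I δ) u u' Θ' → ∀ τ ∈ J, 0 ≤ τ →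
        energy D α (u τ - u' τ) (Θ τ - Θ' τ)
          ≤ energy D α (u 0 - u' 0) (Θ 0 - Θ' 0) * Real.exp (-(2 * β) * τ) := by
  have hDo := hD.isOpen
  have hDb := hD.isBounded
  have hv := volume_real_cyl_pos hDo hD.isConnected.nonempty hDb
  obtain ⟨C, hC0, hC⟩ := velocity_difference hDo
  obtain ⟨Q, hQ0, hQ⟩ := exists_norm_le_gradNorm hDo hDb
  -- `A` collects the coefficients of $\|w\|\|\nabla w\|$: stretching, and 1 from the interpolation
  -- error. `B` collects those of $\|w\|\|\nabla z\|$: buoyancy through Poincaré's inequality, and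
  -- the transport of $\Theta$.
  set A := C * ℰ + 1
  set B := 2 * M * Q + 2 * ℰ
  -- The added 1 keeps the denominator of the rate positive even if `Q` is zero.
  have hp : 0 < Q ^ 2 + 1 := by positivity
  refine ⟨2 + A ^ 2 / (4 * μ) + B ^ 2 / (2 * κ), by positivity,
    min 1 (κ / (2 * (Q ^ 2 + 1))), lt_min one_pos (by positivity), ?_⟩
  intro Λ hΛ ρ Ibar I hI δ hδ hρ g θB hM u Θ hu J hJ h0J u' Θ' hu' τ hτ hτ0
  have hΛ0 : 0 ≤ Λ := le_trans (by positivity) hΛ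
  have hsub : Ioo 0 τ ⊆ J := Ioo_subset_Icc_self.trans (hJ.out h0J hτ)
  have onIoo {p : ℝ → Prop} {S : Set ℝ} (hS : Ioo 0 τ ⊆ S) (h : ∀ᵐ t ∂volume.restrict S, p t) :
      ∀ᵐ t, t ∈ Ioo 0 τ → p t :=
    (ae_restrict_iff' measurableSet_Ioo).1 (ae_restrict_of_ae_restrict_of_subset hS h)
  refine le_mul_exp_of_absolutelyContinuous (y := fun t => energy D α (u t - u' t) (Θ t - Θ' t))
    (y' := fun t => 2 * (inner ℝ (deriv u t - deriv u' t) (u t - u' t)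
      + inner ℝ (deriv Θ t - deriv Θ' t) (meanCorrection D α (Θ t - Θ' t)))) hτ0 ?_ ?_ ?_
  · exact absolutelyContinuousOnInterval_energy α
      ((hu.solution.time_u.absolutelyContinuousOnInterval ordConnected_univ trivial trivial hτ0).sub
        (hu'.time_u.absolutelyContinuousOnInterval hJ h0J hτ hτ0))
      ((hu.solution.time_Θ.absolutelyContinuousOnInterval ordConnected_univ trivial trivial hτ0).sub
        (hu'.time_Θ.absolutelyContinuousOnInterval hJ h0J hτ hτ0))
  · filter_upwards [hu.solution.time_u.ae_hasDerivAt ordConnected_univ trivial trivial hτ0,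
      hu'.time_u.ae_hasDerivAt hJ h0J hτ hτ0,
      hu.solution.time_Θ.ae_hasDerivAt ordConnected_univ trivial trivial hτ0,
      hu'.time_Θ.ae_hasDerivAt hJ h0J hτ hτ0] with t h1 h2 h3 h4 ht
    exact hasDerivAt_energy α ((h1 ht).sub (h2 ht)) ((h3 ht).sub (h4 ht))
  · filter_upwards [onIoo (subset_univ _) hu.solution.ae_isVelocity, onIoo hsub hu'.ae_isVelocity,
      onIoo (subset_univ _) hu.solution.ae_isTemperature, onIoo hsub hu'.ae_isTemperature,
      onIoo (subset_univ _) hu.solution.bc_Θ, onIoo hsub hu'.bc_Θ] with t k1 k2 k3 k4 k5 k6 ht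
    have vU := k1 ht
    have vU' := k2 ht
    obtain ⟨z, hz, hz0⟩ := k5 ht
    obtain ⟨z', hz', hz0'⟩ := k6 ht
    have hZ := memW120_meanCorrection hDo hz hz' hz0 hz0'
    have hT := temperature_difference hDo hDb vU.mem_W120 vU'.mem_W120 vU.div_free vU'.div_free
      (k3 ht) (k4 ht) (hu.mem_Θ t).2 hZ
    have hV := hC μ M g _ _ _ _ _ _ _ _ hM vU vU'
    obtain ⟨b1, -, b3⟩ := hu.bounds t
    have hPo := hQ _ hZ
    have hE := energy_le_norm_meanCorrection_sq hα0 hv (Θ t - Θ' t)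
    set w := u t - u' t with hw
    set η := Θ t - Θ' t with hη
    set G := gradNormV D w
    set H := gradNorm e3 (cyl D) (meanCorrection D α η)
    have hG0 : 0 ≤ G := gradNormV_nonneg w
    have hH0 : 0 ≤ H := gradNorm_nonneg _
    have hw0 := norm_nonneg w
    have hN := inner_nudging_le hΛ0 hρ (p := I δ (-w)) (w := w) (G := G)
      (hI.norm_add_le hDo hδ fun i => ((vU.mem_W120 i).sub hDo (vU'.mem_W120 i)).1) hG0
    -- The attractor solution has no force, so the difference of forces is the nudging term with
    -- argument $-w$.
    have hforce : (0 : L2v D) - -(Λ • I δ (u' t - u t)) = Λ • I δ (-w) := by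
      rw [hw, neg_sub, zero_sub, neg_neg]
    rw [hforce] at hV
    have hM0 : 0 ≤ M := by
      obtain ⟨x, hx⟩ := hD.isConnected.nonempty
      exact (norm_nonneg _).trans (hM x hx)
    have hηQ : ‖η‖ ≤ Q * H := by
      refine le_trans (abs_le_of_sq_le_sq' (le_trans ?_ hE) (norm_nonneg _)).2 hPo
      exact le_add_of_nonneg_right
        (mul_nonneg (div_nonneg hα0.le measureReal_nonneg) (mul_self_nonneg _))
    have hy : ‖η‖ ^ 2 + α / (volume : Measure R3).real (cyl D)
        * (inner ℝ (oneCyl D) η * inner ℝ (oneCyl D) η) ≤ (Q ^ 2 + 1) * H ^ 2 := by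
      refine hE.trans ((pow_le_pow_left₀ (norm_nonneg _) hPo 2).trans ?_)
      nlinarith [sq_nonneg H]
    have hdis := dissipation_le (a := ‖w‖) (G := G) hμ hκ hΛ hp hy
    have t1 : C * w12NormV D (u t) * (‖w‖ * G) ≤ C * ℰ * (‖w‖ * G) :=
      mul_le_mul_of_nonneg_right (mul_le_mul_of_nonneg_left b1 hC0) (mul_nonneg hw0 hG0)
    have t2 : 2 * M * ‖η‖ * ‖w‖ ≤ 2 * M * (Q * H) * ‖w‖ :=
      mul_le_mul_of_nonneg_right (mul_le_mul_of_nonneg_left hηQ (by positivity)) hw0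
    have t3 : linfNorm (cyl D) (Θ t) * ‖w‖ * H ≤ ℰ * ‖w‖ * H :=
      mul_le_mul_of_nonneg_right (mul_le_mul_of_nonneg_right b3 hw0) hH0
    have hen : energy D α w η = ‖w‖ ^ 2 + (‖η‖ ^ 2 + α / (volume : Measure R3).real (cyl D)
        * (inner ℝ (oneCyl D) η * inner ℝ (oneCyl D) η)) := by
      rw [energy, real_inner_self_eq_norm_sq, real_inner_self_eq_norm_sq]
    have hAB : A * (‖w‖ * G) + B * (‖w‖ * H) = C * ℰ * (‖w‖ * G) + ‖w‖ * G
        + 2 * M * (Q * H) * ‖w‖ + 2 * (ℰ * ‖w‖ * H) := by ring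
    rw [hen]
    linarith

end ROB

/-! ### Conclusion: from the energy to the norms -/

theorem theorem4p1 (D : Set ROB.R2) (hD : ROB.IsC2Domain D)
    (μ κ α : ℝ) (hμ : 0 < μ) (hκ : 0 < κ) (hα0 : 0 < α) (hα1 : α < 1)
    (M ℰ : ℝ) :
    ∃ Λ₀ > 0, ∃ β > 0, ∃ C > 0, ∀ Λ ≥ Λ₀,
      ∀ ρ : ℝ → ℝ, Tendsto ρ (𝓝[>] 0) (𝓝 0) →
      ∃ δ₀ > 0, ∀ δ, 0 < δ → δ ≤ δ₀ →
      ∀ (Ibar : ℝ → ℝ) (I : ℝ → ROB.L2v D → ROB.L2v D), ROB.IsInterpolant D Ibar ρ I →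
      ∀ (g : ROB.R3) (θB : ROB.R3 → ℝ),
        (∀ x ∈ D, ‖ROB.gradH g (x, 0)‖ ≤ M) → ContDiff ℝ 2 θB →
      ∀ (u : ℝ → ROB.L2v D) (Θ : ℝ → ROB.L2 (ROB.cyl D)),
        ROB.IsInAttractor D ⟨μ, κ, α, g, θB⟩ ℰ u Θ →
      ∀ (J : Set ℝ), J.OrdConnected → IsLeast J 0 →
      ∀ (u' : ℝ → ROB.L2v D) (Θ' : ℝ → ROB.L2 (ROB.cyl D))
        (u₀' : ROB.L2v D) (Θ₀' : ROB.L2 (ROB.cyl D)),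
        ROB.IsNudgedSolution D ⟨μ, κ, α, g, θB⟩ J Λ (I δ) u u' Θ' →
        u' 0 = u₀' → Θ' 0 = Θ₀' →
      ∀ τ ∈ J, ‖u τ - u' τ‖ + ‖Θ τ - Θ' τ‖
        ≤ C * (1 + ‖u₀'‖ + ‖Θ₀'‖) * Real.exp (-β * τ) := by
  have := ROB.isFiniteMeasure_restrict_cyl hD.isBounded
  have hv := ROB.volume_real_cyl_pos hD.isOpen hD.isConnected.nonempty hD.isBounded
  obtain ⟨Λ₀, hΛ₀, β, hβ, H⟩ := ROB.exists_energy_decay hD hμ hκ hα0 M ℰ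
  -- The term $2|\mathcal E|$ bounds the attractor solution at time zero, and the factor 4 comes
  -- from comparing the energy with the sum of the norms.
  refine ⟨Λ₀, hΛ₀, β, hβ, 4 * (2 * |ℰ| + 1), by positivity, fun Λ hΛ ρ hρ => ?_⟩
  have hlim : Tendsto (fun δ => Λ * |ρ δ|) (𝓝[>] 0) (𝓝 0) := by
    simpa using hρ.abs.const_mul Λ
  -- The threshold depends only on $\Lambda$ and $\rho$: it ensures $\Lambda|\rho(\delta)|\le1$ on
  -- $(0,\delta_0]$.
  obtain ⟨δ₀, hδ₀, hsmall⟩ := mem_nhdsGT_iff_exists_Ioc_subset.1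
    (hlim.eventually_le_const one_pos)
  refine ⟨δ₀, hδ₀, ?_⟩
  rintro δ hδ hδle Ibar I hI g θB hM - u Θ hu J hJ hJ0 u' Θ' _ _ hu' rfl rfl τ hτ
  have hdec := H Λ hΛ ρ Ibar I hI δ hδ (hsmall ⟨hδ, hδle⟩) g θB hM u Θ hu J hJ hJ0.1 u' Θ' hu' τ hτ
    (hJ0.2 hτ)
  have hlow := ROB.sq_add_sq_le_energy hα0 (u τ - u' τ) (Θ τ - Θ' τ)
  have hup := ROB.energy_le hα0 hα1 hv (u 0 - u' 0) (Θ 0 - Θ' 0)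
  obtain ⟨b1, b2, -⟩ := hu.bounds 0
  have hexp : Real.exp (-(2 * β) * τ) = Real.exp (-β * τ) ^ 2 := by
    rw [← Real.exp_nat_mul]
    congr 1
    push_cast
    ring
  have h0 : ‖u 0 - u' 0‖ + ‖Θ 0 - Θ' 0‖ ≤ (2 * |ℰ| + 1) * (1 + ‖u' 0‖ + ‖Θ' 0‖) := by
    have h1 := norm_sub_le (u 0) (u' 0)
    have h2 := norm_sub_le (Θ 0) (Θ' 0)
    have h3 := ROB.norm_le_w12NormV (u 0)
    have h4 := le_abs_self ℰ
    nlinarith [mul_nonneg (abs_nonneg ℰ) (norm_nonneg (u' 0)),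
      mul_nonneg (abs_nonneg ℰ) (norm_nonneg (Θ' 0))]
  set a := ‖u τ - u' τ‖
  set n := ‖Θ τ - Θ' τ‖
  set s := ‖u 0 - u' 0‖ + ‖Θ 0 - Θ' 0‖ with hs
  set E := Real.exp (-β * τ)
  have hE : 0 ≤ E := (Real.exp_pos _).le
  have hs0 : 0 ≤ s := by positivity
  -- Here $(a+n)^2\le2(a^2+n^2)\le 2(2s)^2E^2=8s^2E^2$, which is below $16s^2E^2$.
  have hsq : (a + n) ^ 2 ≤ (4 * s * E) ^ 2 := by
    have h1 := mul_le_mul_of_nonneg_right hup (sq_nonneg E)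
    rw [hexp] at hdec
    nlinarith [sq_nonneg (a - n), mul_nonneg (sq_nonneg s) (sq_nonneg E)]
  calc a + n ≤ 4 * s * E := (abs_le_of_sq_le_sq' hsq (by positivity)).2
    _ ≤ 4 * ((2 * |ℰ| + 1) * (1 + ‖u' 0‖ + ‖Θ' 0‖)) * E := by gcongr
    _ = 4 * (2 * |ℰ| + 1) * (1 + ‖u' 0‖ + ‖Θ' 0‖) * E := by ring
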